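/- **The calculus.** Fix a countably infinite set of variables ($x,y,z,k,f,l$) and a countably infinite set of prompts ($p,q$). Expressions $e$, values $v$ and evaluation contexts $E$ of the multi-prompt calculus are given by $$e ::= v \mid e\,e \mid \mathcal{N}x.e \mid \#_v\,e \mid \mathcal{G}_v\,x.e \mid v\triangleleft e,\qquad v ::= x \mid \lambda x.e \mid p \mid \ulcorner E\urcorner,\qquad E ::= \square \mid E\,e \mid v\,E \mid \#_p\,E .$$ Terms are taken up to renaming of the bound variables ($\lambda x.e$, $\mathcal{N}x.e$ and $\mathcal{G}_v\,x.e$ bind $x$ in $e$). Here $\mathcal{N}x.e$ generates a fresh prompt, $\#_v\,e$ is a delimiter, $\mathcal{G}_v\,x.e$ captures a continuation and $v\triangleleft e$ throws $e$ to $v$. $E[e]$ is the result of plugging $e$ in the hole of $E$. $\mathrm{pr}(m)$ is the set of prompts occurring in $m$, and $\mathrm{sp}(E)$ is the set of the prompts $p$ such that $E=E_1[\#_p E_2]$ for some $E_1,E_2$. Write $\mathrm{fr}(m_1,m_2,m_3)$ for $(\mathrm{pr}(m_1)\setminus\mathrm{pr}(m_2))\cap\mathrm{pr}(m_3)=\emptyset$.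 Reduction is the least relation with - $(\lambda x.e)\,v\to e\{v/x\}$; $\quad\#_p\,v\to v$; $\quad\ulcorner E\urcorner\triangleleft e\to E[e]$; - $\#_p\,E[\mathcal{G}_p\,x.e]\to e\{\ulcorner E\urcorner/x\}$ if $p\notin\mathrm{sp}(E)$; - $\mathcal{N}x.e\to e\{p/x\}$ if $p\notin\mathrm{pr}(e)$; - $E[e_1]\to E[e_2]$ if $e_1\to e_2$ and $\mathrm{fr}(e_2,e_1,E)$. Write $e\Rrightarrow e'$ if $e\to e'$, or if $e$ is a normal form and $e'=e$. **Multi-hole contexts.** These are given by the promptless grammars $$C ::= V \mid C\,C \mid \mathcal{N}x.C \mid \#_V\,C \mid \mathcal{G}_V\,x.C \mid V\triangleleft C,\qquad V ::= x \mid \lambda x.C \mid \ulcorner F\urcorner \mid \square_i,\qquad F ::= \square \mid F\,C \mid V\,F \mid \#_{\square_i}F .$$ For a finite sequence $\Gamma$ of closed values, $C[\Gamma]$, $V[\Gamma]$ and $F[\Gamma]$ are obtained by replacing each $\square_i$ with the $i$-th element $\Gamma_i$. This is defined when every index is within the range of $\Gamma$ and $\Gamma_i$ is a prompt for each construct $\#_{\square_i}F$.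 $F[e,\Gamma]$ is $E[e]$ with $E=F[\Gamma]$. **States and transitions.** A state $(\Gamma,e)$ consists of a finite sequence $\Gamma$ of closed values and a closed expression $e$. If $e$ is a value $v$, the state $(\Gamma,v)$ is identified with the sequence $\Gamma,v$, and a sequence of closed values alone is a state. The transitions, where the contexts $C,V,F$ in the labels are closed and the applications to $\Gamma$ are defined, are - $(\Gamma,e_1)\xrightarrow{\tau}(\Gamma,e_2)$ if $e_1\to e_2$ and $\mathrm{fr}(e_2,e_1,\Gamma)$; - $\Gamma\xrightarrow{\lambda,i,V}(\Gamma,e\{V[\Gamma]/x\})$ if $\Gamma_i=\lambda x.e$; - $\Gamma\xrightarrow{\mathrm{val}}\Gamma$; - $\Gamma\xrightarrow{\ulcorner\cdot\urcorner,i,C}(\Gamma,E[C[\Gamma]])$ if $\Gamma_i=\ulcorner E\urcorner$; - $\Gamma\xrightarrow{\#,i,j}\Gamma$ if $\Gamma_i=\Gamma_j=p$ for some prompt $p$; - $\Gamma\xrightarrow{\mathrm{new}}(\Gamma,p)$ if $p\notin\mathrm{pr}(\Gamma)$; - $(\Gamma,E[\mathcal{G}_p\,x.e])\xrightarrow{F}(\Gamma,e')$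 if $p\notin\mathrm{sp}(E)$ and $F[E[\mathcal{G}_p\,x.e],\Gamma]\Rrightarrow e'$. The weak transition $\Rightarrow^{\alpha}$ is $(\xrightarrow{\tau})^*$ if $\alpha=\tau$, and $(\xrightarrow{\tau})^*\xrightarrow{\alpha}(\xrightarrow{\tau})^*$ otherwise. A bisimulation is a relation $R$ on states such that, whenever $S\mathrel{R}T$: if $S\xrightarrow{\alpha}S'$ then there is $T'$ with $T\Rightarrow^{\alpha}T'$ and $S'\mathrel{R}T'$; and if $T\xrightarrow{\alpha}T'$ then there is $S'$ with $S\Rightarrow^{\alpha}S'$ and $S'\mathrel{R}T'$. Bisimilarity $\approx$ is the union of all bisimulations. Closed expressions $e_1,e_2$ are bisimilar if $(\emptyset,e_1)\approx(\emptyset,e_2)$. **Theorem (folklore theorem).** For a prompt $p$ let $$\mathsf{shift}_p=\lambda f.\,\mathcal{G}_p\,k.\,\#_p\,(f\,(\lambda y.\,\#_p\,(k\triangleleft y))),\qquad \mathsf{control}_p=\lambda f.\,\mathcal{G}_p\,k.\,\#_p\,(f\,(\lambda y.\,k\triangleleft y)),$$ $$\mathsf{reset}_p=\ulcorner\#_p\,\square\urcorner,\qquad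 \mathsf{prompt}_p=\ulcorner\#_p\,\square\urcorner,\qquad \mathsf{shift}'_p=\lambda f.\,\mathsf{control}_p\,(\lambda l.\,f\,(\lambda z.\,\mathsf{prompt}_p\triangleleft(l\,z))).$$ Then, for every prompt $p$, the encoding $\lambda f.\,f\,\mathsf{shift}_p\,\mathsf{reset}_p$ of the pair $(\mathsf{shift}_p,\mathsf{reset}_p)$ and the encoding $\lambda f.\,f\,\mathsf{shift}'_p\,\mathsf{prompt}_p$ of the pair $(\mathsf{shift}'_p,\mathsf{prompt}_p)$ are bisimilar: $$(\emptyset,\ \lambda f.\,f\,\mathsf{shift}_p\,\mathsf{reset}_p)\ \approx\ (\emptyset,\ \lambda f.\,f\,\mathsf{shift}'_p\,\mathsf{prompt}_p).$$ -/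

import Mathlib

namespace MultiPrompt

/-- Prompts: a countably infinite set of names. -/
abbrev Prompt : Type := ℕ

/-! ## Terms

`Expr n`, `Val n`, `ECtx n` are the expressions, values and evaluation contexts whose free
variables are among `n` de Bruijn indices; `Expr 0` is the type of closed expressions.
Terms are thereby identified up to renaming of bound variables. -/

mutual

inductive Expr : ℕ → Type
  | val {n : ℕ} (v : Val n) : Expr n
  | app {n : ℕ} (e₁ e₂ : Expr n) : Expr n
  /-- Generation of a fresh prompt, bound to variable `0` of the body. -/
  | fresh {n : ℕ} (e : Expr (n + 1)) : Expr n
  /-- The control delimiter. -/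
  | reset {n : ℕ} (v : Val n) (e : Expr n) : Expr n
  /-- The capture construct; the captured context is bound to variable `0` of the body. -/
  | grab {n : ℕ} (v : Val n) (e : Expr (n + 1)) : Expr n
  | throw {n : ℕ} (v : Val n) (e : Expr n) : Expr n

inductive Val : ℕ → Type
  | var {n : ℕ} (i : Fin n) : Val n
  | lam {n : ℕ} (e : Expr (n + 1)) : Val n
  | prompt {n : ℕ} (p : Prompt) : Val n
  /-- A captured evaluation context. -/
  | cont {n : ℕ} (E : ECtx n) : Val n

/-- Evaluation contexts, read outside-in. -/
inductive ECtx : ℕ → Type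
  | hole {n : ℕ} : ECtx n
  | appL {n : ℕ} (E : ECtx n) (e : Expr n) : ECtx n
  | appR {n : ℕ} (v : Val n) (E : ECtx n) : ECtx n
  | reset {n : ℕ} (p : Prompt) (E : ECtx n) : ECtx n

end

/-! ## Renaming and capture-avoiding substitution -/

def liftRen {m n : ℕ} (ρ : Fin m → Fin n) : Fin (m + 1) → Fin (n + 1) :=
  Fin.cases 0 (fun i => (ρ i).succ)

mutual

def Expr.rename {m n : ℕ} (ρ : Fin m → Fin n) : Expr m → Expr n
  | .val v => .val (v.rename ρ)
  | .app e₁ e₂ => .app (e₁.rename ρ) (e₂.rename ρ)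
  | .fresh e => .fresh (e.rename (liftRen ρ))
  | .reset v e => .reset (v.rename ρ) (e.rename ρ)
  | .grab v e => .grab (v.rename ρ) (e.rename (liftRen ρ))
  | .throw v e => .throw (v.rename ρ) (e.rename ρ)

def Val.rename {m n : ℕ} (ρ : Fin m → Fin n) : Val m → Val n
  | .var i => .var (ρ i)
  | .lam e => .lam (e.rename (liftRen ρ))
  | .prompt p => .prompt p
  | .cont E => .cont (E.rename ρ)

def ECtx.rename {m n : ℕ} (ρ : Fin m → Fin n) : ECtx m → ECtx n
  | .hole => .hole
  | .appL E e => .appL (E.rename ρ) (e.rename ρ)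
  | .appR v E => .appR (v.rename ρ) (E.rename ρ)
  | .reset p E => .reset p (E.rename ρ)

end

def liftSub {m n : ℕ} (σ : Fin m → Val n) : Fin (m + 1) → Val (n + 1) :=
  Fin.cases (.var 0) (fun i => (σ i).rename Fin.succ)

mutual

def Expr.subst {m n : ℕ} (σ : Fin m → Val n) : Expr m → Expr n
  | .val v => .val (v.subst σ)
  | .app e₁ e₂ => .app (e₁.subst σ) (e₂.subst σ)
  | .fresh e => .fresh (e.subst (liftSub σ))
  | .reset v e => .reset (v.subst σ) (e.subst σ)
  | .grab v e => .grab (v.subst σ) (e.subst (liftSub σ))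
  | .throw v e => .throw (v.subst σ) (e.subst σ)

def Val.subst {m n : ℕ} (σ : Fin m → Val n) : Val m → Val n
  | .var i => σ i
  | .lam e => .lam (e.subst (liftSub σ))
  | .prompt p => .prompt p
  | .cont E => .cont (E.subst σ)

def ECtx.subst {m n : ℕ} (σ : Fin m → Val n) : ECtx m → ECtx n
  | .hole => .hole
  | .appL E e => .appL (E.subst σ) (e.subst σ)
  | .appR v E => .appR (v.subst σ) (E.subst σ)
  | .reset p E => .reset p (E.subst σ)

end

/-- `e.inst v` is the expression `e` with variable `0` replaced by the value `v`. -/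
def Expr.inst {n : ℕ} (e : Expr (n + 1)) (v : Val n) : Expr n :=
  e.subst (Fin.cases v Val.var)

/-- `E.plug e` is `E` with its hole filled with `e`. -/
def ECtx.plug {n : ℕ} : ECtx n → Expr n → Expr n
  | .hole, e => e
  | .appL E e', e => .app (E.plug e) e'
  | .appR v E, e => .app (.val v) (E.plug e)
  | .reset p E, e => .reset (.prompt p) (E.plug e)

/-! ## Prompts of terms -/

mutual

/-- All the prompts that occur in an expression. -/
def Expr.prompts {n : ℕ} : Expr n → Finset Prompt
  | .val v => v.prompts
  | .app e₁ e₂ => e₁.prompts ∪ e₂.prompts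
  | .fresh e => e.prompts
  | .reset v e => v.prompts ∪ e.prompts
  | .grab v e => v.prompts ∪ e.prompts
  | .throw v e => v.prompts ∪ e.prompts

/-- All the prompts that occur in a value. -/
def Val.prompts {n : ℕ} : Val n → Finset Prompt
  | .var _ => ∅
  | .lam e => e.prompts
  | .prompt p => {p}
  | .cont E => E.prompts

/-- All the prompts that occur in an evaluation context. -/
def ECtx.prompts {n : ℕ} : ECtx n → Finset Prompt
  | .hole => ∅
  | .appL E e => E.prompts ∪ e.prompts
  | .appR v E => v.prompts ∪ E.prompts
  | .reset p E => {p} ∪ E.prompts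

end

/-- The surrounding prompts of `E`: those whose delimiter guards the hole of `E`. -/
def ECtx.surr {n : ℕ} : ECtx n → Finset Prompt
  | .hole => ∅
  | .appL E _ => E.surr
  | .appR _ E => E.surr
  | .reset p E => {p} ∪ E.surr

/-- The prompts of `A` that are new with respect to `B` do not occur in `C`. -/
def PromptsFresh (A B C : Finset Prompt) : Prop := (A \ B) ∩ C = ∅

/-! ## Reduction semantics -/

inductive Red {n : ℕ} : Expr n → Expr n → Prop
  | beta (e : Expr (n + 1)) (v : Val n) : Red (.app (.val (.lam e)) (.val v)) (e.inst v)
  | resetVal (p : Prompt) (v : Val n) : Red (.reset (.prompt p) (.val v)) (.val v)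
  | grab (p : Prompt) (E : ECtx n) (e : Expr (n + 1)) (hp : p ∉ E.surr) :
      Red (.reset (.prompt p) (E.plug (.grab (.prompt p) e))) (e.inst (.cont E))
  | throw (E : ECtx n) (e : Expr n) : Red (.throw (.cont E) e) (E.plug e)
  | fresh (e : Expr (n + 1)) (p : Prompt) (hp : p ∉ e.prompts) :
      Red (.fresh e) (e.inst (.prompt p))
  | compat (E : ECtx n) (e₁ e₂ : Expr n) (h : Red e₁ e₂)
      (hf : PromptsFresh e₂.prompts e₁.prompts E.prompts) : Red (E.plug e₁) (E.plug e₂)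

/-- One reduction step, or no step for an expression that is a normal form. -/
def RedOrNormal {n : ℕ} (e e' : Expr n) : Prop :=
  Red e e' ∨ ((¬ ∃ e'', Red e e'') ∧ e' = e)

/-! ## Multi-hole contexts

They are promptless; the indexed hole `□ᵢ` stands for the `i`-th value (counted from `0`) of an
environment, and the non-indexed hole of an evaluation context is in evaluation position. -/

mutual

inductive MExpr : ℕ → Type
  | val {n : ℕ} (C : MVal n) : MExpr n
  | app {n : ℕ} (C₁ C₂ : MExpr n) : MExpr n
  | fresh {n : ℕ} (C : MExpr (n + 1)) : MExpr n
  | reset {n : ℕ} (V : MVal n) (C : MExpr n) : MExpr n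
  | grab {n : ℕ} (V : MVal n) (C : MExpr (n + 1)) : MExpr n
  | throw {n : ℕ} (V : MVal n) (C : MExpr n) : MExpr n

inductive MVal : ℕ → Type
  | var {n : ℕ} (x : Fin n) : MVal n
  | lam {n : ℕ} (C : MExpr (n + 1)) : MVal n
  | cont {n : ℕ} (E : MCtx n) : MVal n
  /-- The indexed hole. -/
  | idx {n : ℕ} (i : ℕ) : MVal n

inductive MCtx : ℕ → Type
  | hole {n : ℕ} : MCtx n
  | appL {n : ℕ} (E : MCtx n) (C : MExpr n) : MCtx n
  | appR {n : ℕ} (V : MVal n) (E : MCtx n) : MCtx n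
  /-- A delimiter whose prompt is the indexed hole `i`. -/
  | reset {n : ℕ} (i : ℕ) (E : MCtx n) : MCtx n

end

/-- Environments: finite sequences of closed values. -/
abbrev Env : Type := List (Val 0)

/-- All the prompts that occur in the values of an environment. -/
def Env.prompts : Env → Finset Prompt
  | [] => ∅
  | v :: Γ => v.prompts ∪ Env.prompts Γ

/-- The `i`-th value of `Γ`, seen in a scope of `n` variables; it is only used when there is
such a value. -/
def Env.valAt {n : ℕ} (Γ : Env) (i : ℕ) : Val n :=
  match Γ[i]? with
  | some v => v.rename Fin.elim0
  | none => .prompt 0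

/-- The prompt that is the `i`-th value of `Γ`; it is only used when that value is a prompt. -/
def Env.promptAt (Γ : Env) (i : ℕ) : Prompt :=
  match Γ[i]? with
  | some (.prompt p) => p
  | _ => 0

mutual

/-- `C.Fits Γ`: the application of `C` to `Γ` is defined, that is, each hole index of `C` is
within the range of `Γ`, and is sent to a prompt if it is that of a delimiter of an evaluation
context. -/
def MExpr.Fits {n : ℕ} (Γ : Env) : MExpr n → Prop
  | .val V => V.Fits Γ
  | .app C₁ C₂ => C₁.Fits Γ ∧ C₂.Fits Γ
  | .fresh C => C.Fits Γ
  | .reset V C => V.Fits Γ ∧ C.Fits Γ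
  | .grab V C => V.Fits Γ ∧ C.Fits Γ
  | .throw V C => V.Fits Γ ∧ C.Fits Γ

def MVal.Fits {n : ℕ} (Γ : Env) : MVal n → Prop
  | .var _ => True
  | .lam C => C.Fits Γ
  | .cont E => E.Fits Γ
  | .idx i => i < Γ.length

def MCtx.Fits {n : ℕ} (Γ : Env) : MCtx n → Prop
  | .hole => True
  | .appL E C => E.Fits Γ ∧ C.Fits Γ
  | .appR V E => V.Fits Γ ∧ E.Fits Γ
  | .reset i E => (∃ p, Γ[i]? = some (.prompt p)) ∧ E.Fits Γ

end

mutual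

/-- `C.fill Γ` is the application of `C` to `Γ`: the indexed holes are replaced by the
corresponding values of `Γ`. It is only used when `C.Fits Γ`. -/
def MExpr.fill {n : ℕ} (Γ : Env) : MExpr n → Expr n
  | .val V => .val (V.fill Γ)
  | .app C₁ C₂ => .app (C₁.fill Γ) (C₂.fill Γ)
  | .fresh C => .fresh (C.fill Γ)
  | .reset V C => .reset (V.fill Γ) (C.fill Γ)
  | .grab V C => .grab (V.fill Γ) (C.fill Γ)
  | .throw V C => .throw (V.fill Γ) (C.fill Γ)

def MVal.fill {n : ℕ} (Γ : Env) : MVal n → Val n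
  | .var x => .var x
  | .lam C => .lam (C.fill Γ)
  | .cont E => .cont (E.fill Γ)
  | .idx i => Γ.valAt i

def MCtx.fill {n : ℕ} (Γ : Env) : MCtx n → ECtx n
  | .hole => .hole
  | .appL E C => .appL (E.fill Γ) (C.fill Γ)
  | .appR V E => .appR (V.fill Γ) (E.fill Γ)
  | .reset i E => .reset (Γ.promptAt i) (E.fill Γ)

end

/-! ## States and the labelled transition system -/

def Expr.IsVal {n : ℕ} (e : Expr n) : Prop := ∃ v, e = .val v

/-- A state is either a sequence of closed values, or a sequence of closed values together with
a closed expression that is not a value. -/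
inductive State : Type
  | vals (Γ : Env) : State
  | run (Γ : Env) (e : Expr 0) (he : ¬ e.IsVal) : State

open Classical in
/-- The state `(Γ, e)`; when `e` is a value, it is the extended sequence `Γ, e`. -/
noncomputable def State.of (Γ : Env) (e : Expr 0) : State :=
  if h : e.IsVal then .vals (Γ ++ [h.choose]) else .run Γ e h

theorem State.of_val (Γ : Env) (v : Val 0) : State.of Γ (.val v) = .vals (Γ ++ [v]) := by
  have h : (Expr.val v).IsVal := ⟨v, rfl⟩
  have hc : v = h.choose := by
    have := h.choose_spec
    injection this
  rw [State.of, dif_pos h, ← hc]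

theorem State.of_not_val (Γ : Env) (e : Expr 0) (h : ¬ e.IsVal) :
    State.of Γ e = .run Γ e h := by
  rw [State.of, dif_neg h]

/-- Labels; the testing contexts are closed. -/
inductive Label : Type
  | tau : Label
  | lam (i : ℕ) (V : MVal 0) : Label
  | val : Label
  | ctx (i : ℕ) (C : MExpr 0) : Label
  | prompt (i j : ℕ) : Label
  | newPrompt : Label
  | stuck (F : MCtx 0) : Label

inductive Step : State → Label → State → Prop
  | tau (Γ : Env) (e₁ e₂ : Expr 0) (he : ¬ e₁.IsVal) (h : Red e₁ e₂)
      (hf : PromptsFresh e₂.prompts e₁.prompts Γ.prompts) :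
      Step (.run Γ e₁ he) .tau (.of Γ e₂)
  | lam (Γ : Env) (i : ℕ) (e : Expr 1) (V : MVal 0) (hi : Γ[i]? = some (.lam e))
      (hV : V.Fits Γ) :
      Step (.vals Γ) (.lam i V) (.of Γ (e.inst (V.fill Γ)))
  | val (Γ : Env) : Step (.vals Γ) .val (.vals Γ)
  | ctx (Γ : Env) (i : ℕ) (E : ECtx 0) (C : MExpr 0) (hi : Γ[i]? = some (.cont E))
      (hC : C.Fits Γ) :
      Step (.vals Γ) (.ctx i C) (.of Γ (E.plug (C.fill Γ)))
  | prompt (Γ : Env) (i j : ℕ) (p : Prompt) (hi : Γ[i]? = some (.prompt p))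
      (hj : Γ[j]? = some (.prompt p)) :
      Step (.vals Γ) (.prompt i j) (.vals Γ)
  | newPrompt (Γ : Env) (p : Prompt) (hp : p ∉ Γ.prompts) :
      Step (.vals Γ) .newPrompt (.vals (Γ ++ [.prompt p]))
  | stuck (Γ : Env) (e : Expr 0) (he : ¬ e.IsVal) (p : Prompt) (E : ECtx 0) (b : Expr 1)
      (e' : Expr 0) (F : MCtx 0) (hp : p ∉ E.surr) (heq : e = E.plug (.grab (.prompt p) b))
      (hF : F.Fits Γ) (h : RedOrNormal ((F.fill Γ).plug e) e') :
      Step (.run Γ e he) (.stuck F) (.of Γ e')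

/-- Finitely many (possibly zero) internal transitions. -/
def TauStar : State → State → Prop :=
  Relation.ReflTransGen (fun s s' => Step s .tau s')

/-- Weak transitions. -/
def WeakStep (s : State) (a : Label) (s' : State) : Prop :=
  (a = .tau ∧ TauStar s s') ∨
    (a ≠ .tau ∧ ∃ s₁ s₂, TauStar s s₁ ∧ Step s₁ a s₂ ∧ TauStar s₂ s')

/-! ## Bisimilarity -/

/-- The relation `R` progresses to the relation `S`. -/
def Progresses (R S : State → State → Prop) : Prop :=
  (∀ s t, R s t → S s t) ∧
  ∀ s t, R s t →
    (∀ a s', Step s a s' → ∃ t', WeakStep t a t' ∧ S s' t') ∧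
    (∀ a t', Step t a t' → ∃ s', WeakStep s a s' ∧ S s' t')

def IsBisimulation (R : State → State → Prop) : Prop := Progresses R R

/-- Bisimilarity: the union of all bisimulations. -/
def Bisimilar (s t : State) : Prop := ∃ R, IsBisimulation R ∧ R s t

/-! ## The encodings of the control operators -/

/-- `λf. grab_p k. reset_p (f (λy. reset_p (throw k y)))` -/
def shiftOp (p : Prompt) {n : ℕ} : Val n :=
  .lam (.grab (.prompt p) (.reset (.prompt p)
    (.app (.val (.var 1)) (.val (.lam (.reset (.prompt p)
      (.throw (.var 1) (.val (.var 0)))))))))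

/-- `λf. grab_p k. reset_p (f (λy. throw k y))` -/
def controlOp (p : Prompt) {n : ℕ} : Val n :=
  .lam (.grab (.prompt p) (.reset (.prompt p)
    (.app (.val (.var 1)) (.val (.lam (.throw (.var 1) (.val (.var 0))))))))

/-- The captured context `reset_p □`. -/
def resetOp (p : Prompt) {n : ℕ} : Val n := .cont (.reset p .hole)

/-- The captured context `reset_p □`. -/
def promptOp (p : Prompt) {n : ℕ} : Val n := .cont (.reset p .hole)

/-- `λf. control_p (λl. f (λz. throw prompt_p (l z)))` -/
def shiftOp' (p : Prompt) {n : ℕ} : Val n :=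
  .lam (.app (.val (controlOp p))
    (.val (.lam (.app (.val (.var 1))
      (.val (.lam (.throw (promptOp p) (.app (.val (.var 1)) (.val (.var 0))))))))))

/-- The pair of two values `v` and `w`, encoded as `λf. f v w` (`f` is variable `0`). -/
def pairEnc (v w : Val 1) : Val 0 :=
  .lam (.app (.app (.val (.var 0)) (.val v)) (.val w))

end MultiPrompt

namespace MultiPrompt

/-! ## Renaming and substitution -/

theorem liftRen_comp {l m n : ℕ} (ρ : Fin l → Fin m) (ρ' : Fin m → Fin n) :
    liftRen ρ' ∘ liftRen ρ = liftRen (ρ' ∘ ρ) := by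
  funext i
  refine Fin.cases ?_ (fun i => ?_) i <;> rfl

theorem liftSub_comp_liftRen {l m n : ℕ} (ρ : Fin l → Fin m) (σ : Fin m → Val n) :
    liftSub σ ∘ liftRen ρ = liftSub (σ ∘ ρ) := by
  funext i
  refine Fin.cases ?_ (fun i => ?_) i <;> rfl

theorem liftSub_var {n : ℕ} : liftSub (Val.var : Fin n → Val n) = Val.var := by
  funext i
  refine Fin.cases ?_ (fun i => ?_) i
  · rfl
  · simp [liftSub, Val.rename]

mutual

theorem Expr.rename_rename {l m n : ℕ} (ρ : Fin l → Fin m) (ρ' : Fin m → Fin n) :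
    ∀ e : Expr l, (e.rename ρ).rename ρ' = e.rename (ρ' ∘ ρ)
  | .val v => by simp only [Expr.rename, Val.rename_rename ρ ρ' v]
  | .app e₁ e₂ => by
      simp only [Expr.rename, Expr.rename_rename ρ ρ' e₁, Expr.rename_rename ρ ρ' e₂]
  | .fresh e => by
      simp only [Expr.rename, Expr.rename_rename (liftRen ρ) (liftRen ρ') e, liftRen_comp]
  | .reset v e => by
      simp only [Expr.rename, Val.rename_rename ρ ρ' v, Expr.rename_rename ρ ρ' e]
  | .grab v e => by
      simp only [Expr.rename, Val.rename_rename ρ ρ' v,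
        Expr.rename_rename (liftRen ρ) (liftRen ρ') e, liftRen_comp]
  | .throw v e => by
      simp only [Expr.rename, Val.rename_rename ρ ρ' v, Expr.rename_rename ρ ρ' e]

theorem Val.rename_rename {l m n : ℕ} (ρ : Fin l → Fin m) (ρ' : Fin m → Fin n) :
    ∀ v : Val l, (v.rename ρ).rename ρ' = v.rename (ρ' ∘ ρ)
  | .var i => rfl
  | .lam e => by
      simp only [Val.rename, Expr.rename_rename (liftRen ρ) (liftRen ρ') e, liftRen_comp]
  | .prompt p => rfl
  | .cont E => by simp only [Val.rename, ECtx.rename_rename ρ ρ' E]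

theorem ECtx.rename_rename {l m n : ℕ} (ρ : Fin l → Fin m) (ρ' : Fin m → Fin n) :
    ∀ E : ECtx l, (E.rename ρ).rename ρ' = E.rename (ρ' ∘ ρ)
  | .hole => rfl
  | .appL E e => by
      simp only [ECtx.rename, ECtx.rename_rename ρ ρ' E, Expr.rename_rename ρ ρ' e]
  | .appR v E => by
      simp only [ECtx.rename, ECtx.rename_rename ρ ρ' E, Val.rename_rename ρ ρ' v]
  | .reset p E => by simp only [ECtx.rename, ECtx.rename_rename ρ ρ' E]

end

theorem Val.rename_succ_rename {m n : ℕ} (ρ : Fin m → Fin n) (v : Val m) :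
    (v.rename Fin.succ).rename (liftRen ρ) = (v.rename ρ).rename Fin.succ := by
  rw [Val.rename_rename, Val.rename_rename]
  rfl

mutual

theorem Expr.rename_subst {l m n : ℕ} (ρ : Fin l → Fin m) (σ : Fin m → Val n) :
    ∀ e : Expr l, (e.rename ρ).subst σ = e.subst (σ ∘ ρ)
  | .val v => by simp only [Expr.rename, Expr.subst, Val.rename_subst ρ σ v]
  | .app e₁ e₂ => by
      simp only [Expr.rename, Expr.subst, Expr.rename_subst ρ σ e₁, Expr.rename_subst ρ σ e₂]
  | .fresh e => by
      simp only [Expr.rename, Expr.subst, Expr.rename_subst (liftRen ρ) (liftSub σ) e,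
        liftSub_comp_liftRen]
  | .reset v e => by
      simp only [Expr.rename, Expr.subst, Val.rename_subst ρ σ v, Expr.rename_subst ρ σ e]
  | .grab v e => by
      simp only [Expr.rename, Expr.subst, Val.rename_subst ρ σ v,
        Expr.rename_subst (liftRen ρ) (liftSub σ) e, liftSub_comp_liftRen]
  | .throw v e => by
      simp only [Expr.rename, Expr.subst, Val.rename_subst ρ σ v, Expr.rename_subst ρ σ e]

theorem Val.rename_subst {l m n : ℕ} (ρ : Fin l → Fin m) (σ : Fin m → Val n) :
    ∀ v : Val l, (v.rename ρ).subst σ = v.subst (σ ∘ ρ)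
  | .var i => rfl
  | .lam e => by
      simp only [Val.rename, Val.subst, Expr.rename_subst (liftRen ρ) (liftSub σ) e,
        liftSub_comp_liftRen]
  | .prompt p => rfl
  | .cont E => by simp only [Val.rename, Val.subst, ECtx.rename_subst ρ σ E]

theorem ECtx.rename_subst {l m n : ℕ} (ρ : Fin l → Fin m) (σ : Fin m → Val n) :
    ∀ E : ECtx l, (E.rename ρ).subst σ = E.subst (σ ∘ ρ)
  | .hole => rfl
  | .appL E e => by
      simp only [ECtx.rename, ECtx.subst, ECtx.rename_subst ρ σ E, Expr.rename_subst ρ σ e]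
  | .appR v E => by
      simp only [ECtx.rename, ECtx.subst, ECtx.rename_subst ρ σ E, Val.rename_subst ρ σ v]
  | .reset p E => by simp only [ECtx.rename, ECtx.subst, ECtx.rename_subst ρ σ E]

end

theorem rename_liftSub {l m n : ℕ} (σ : Fin l → Val m) (ρ : Fin m → Fin n) :
    (fun i => (liftSub σ i).rename (liftRen ρ)) = liftSub (fun i => (σ i).rename ρ) := by
  funext i
  refine Fin.cases ?_ (fun i => ?_) i
  · rfl
  · exact Val.rename_succ_rename ρ (σ i)

mutual

theorem Expr.subst_rename {l m n : ℕ} (σ : Fin l → Val m) (ρ : Fin m → Fin n) :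
    ∀ e : Expr l, (e.subst σ).rename ρ = e.subst (fun i => (σ i).rename ρ)
  | .val v => by simp only [Expr.rename, Expr.subst, Val.subst_rename σ ρ v]
  | .app e₁ e₂ => by
      simp only [Expr.rename, Expr.subst, Expr.subst_rename σ ρ e₁, Expr.subst_rename σ ρ e₂]
  | .fresh e => by
      simp only [Expr.rename, Expr.subst, Expr.subst_rename (liftSub σ) (liftRen ρ) e,
        rename_liftSub]
  | .reset v e => by
      simp only [Expr.rename, Expr.subst, Val.subst_rename σ ρ v, Expr.subst_rename σ ρ e]
  | .grab v e => by
      simp only [Expr.rename, Expr.subst, Val.subst_rename σ ρ v,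
        Expr.subst_rename (liftSub σ) (liftRen ρ) e, rename_liftSub]
  | .throw v e => by
      simp only [Expr.rename, Expr.subst, Val.subst_rename σ ρ v, Expr.subst_rename σ ρ e]

theorem Val.subst_rename {l m n : ℕ} (σ : Fin l → Val m) (ρ : Fin m → Fin n) :
    ∀ v : Val l, (v.subst σ).rename ρ = v.subst (fun i => (σ i).rename ρ)
  | .var i => rfl
  | .lam e => by
      simp only [Val.rename, Val.subst, Expr.subst_rename (liftSub σ) (liftRen ρ) e,
        rename_liftSub]
  | .prompt p => rfl
  | .cont E => by simp only [Val.rename, Val.subst, ECtx.subst_rename σ ρ E]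

theorem ECtx.subst_rename {l m n : ℕ} (σ : Fin l → Val m) (ρ : Fin m → Fin n) :
    ∀ E : ECtx l, (E.subst σ).rename ρ = E.subst (fun i => (σ i).rename ρ)
  | .hole => rfl
  | .appL E e => by
      simp only [ECtx.rename, ECtx.subst, ECtx.subst_rename σ ρ E, Expr.subst_rename σ ρ e]
  | .appR v E => by
      simp only [ECtx.rename, ECtx.subst, ECtx.subst_rename σ ρ E, Val.subst_rename σ ρ v]
  | .reset p E => by simp only [ECtx.rename, ECtx.subst, ECtx.subst_rename σ ρ E]

end

theorem Val.rename_succ_subst {m n : ℕ} (σ : Fin m → Val n) (v : Val m) :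
    (v.rename Fin.succ).subst (liftSub σ) = (v.subst σ).rename Fin.succ := by
  rw [Val.rename_subst, Val.subst_rename]
  rfl

mutual

theorem Expr.subst_var {n : ℕ} : ∀ e : Expr n, e.subst Val.var = e
  | .val v => by simp only [Expr.subst, Val.subst_var v]
  | .app e₁ e₂ => by simp only [Expr.subst, Expr.subst_var e₁, Expr.subst_var e₂]
  | .fresh e => by simp only [Expr.subst, liftSub_var, Expr.subst_var e]
  | .reset v e => by simp only [Expr.subst, Val.subst_var v, Expr.subst_var e]
  | .grab v e => by simp only [Expr.subst, liftSub_var, Val.subst_var v, Expr.subst_var e]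
  | .throw v e => by simp only [Expr.subst, Val.subst_var v, Expr.subst_var e]

theorem Val.subst_var {n : ℕ} : ∀ v : Val n, v.subst Val.var = v
  | .var i => rfl
  | .lam e => by simp only [Val.subst, liftSub_var, Expr.subst_var e]
  | .prompt p => rfl
  | .cont E => by simp only [Val.subst, ECtx.subst_var E]

theorem ECtx.subst_var {n : ℕ} : ∀ E : ECtx n, E.subst Val.var = E
  | .hole => rfl
  | .appL E e => by simp only [ECtx.subst, ECtx.subst_var E, Expr.subst_var e]
  | .appR v E => by simp only [ECtx.subst, ECtx.subst_var E, Val.subst_var v]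
  | .reset p E => by simp only [ECtx.subst, ECtx.subst_var E]

end

theorem Val.rename_succ_inst {n : ℕ} (v w : Val n) :
    (v.rename Fin.succ).subst (Fin.cases w Val.var) = v := by
  rw [Val.rename_subst]
  exact Val.subst_var v

mutual

theorem Expr.prompts_rename {m n : ℕ} (ρ : Fin m → Fin n) :
    ∀ e : Expr m, (e.rename ρ).prompts = e.prompts
  | .val v => by simp only [Expr.rename, Expr.prompts, Val.prompts_rename ρ v]
  | .app e₁ e₂ => by
      simp only [Expr.rename, Expr.prompts, Expr.prompts_rename ρ e₁, Expr.prompts_rename ρ e₂]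
  | .fresh e => by simp only [Expr.rename, Expr.prompts, Expr.prompts_rename (liftRen ρ) e]
  | .reset v e => by
      simp only [Expr.rename, Expr.prompts, Val.prompts_rename ρ v, Expr.prompts_rename ρ e]
  | .grab v e => by
      simp only [Expr.rename, Expr.prompts, Val.prompts_rename ρ v,
        Expr.prompts_rename (liftRen ρ) e]
  | .throw v e => by
      simp only [Expr.rename, Expr.prompts, Val.prompts_rename ρ v, Expr.prompts_rename ρ e]

theorem Val.prompts_rename {m n : ℕ} (ρ : Fin m → Fin n) :
    ∀ v : Val m, (v.rename ρ).prompts = v.prompts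
  | .var i => rfl
  | .lam e => by simp only [Val.rename, Val.prompts, Expr.prompts_rename (liftRen ρ) e]
  | .prompt p => rfl
  | .cont E => by simp only [Val.rename, Val.prompts, ECtx.prompts_rename ρ E]

theorem ECtx.prompts_rename {m n : ℕ} (ρ : Fin m → Fin n) :
    ∀ E : ECtx m, (E.rename ρ).prompts = E.prompts
  | .hole => rfl
  | .appL E e => by
      simp only [ECtx.rename, ECtx.prompts, ECtx.prompts_rename ρ E, Expr.prompts_rename ρ e]
  | .appR v E => by
      simp only [ECtx.rename, ECtx.prompts, ECtx.prompts_rename ρ E, Val.prompts_rename ρ v]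
  | .reset p E => by simp only [ECtx.rename, ECtx.prompts, ECtx.prompts_rename ρ E]

end

/-! ## The simulating relation -/

/-- `λy. throw u y` -/
def throwFun {n : ℕ} (u : Val n) : Val n :=
  .lam (.throw (u.rename Fin.succ) (.val (.var 0)))

/-- `λy. reset_p (throw u y)` -/
def resumeFun (p : Prompt) {n : ℕ} (u : Val n) : Val n :=
  .lam (.reset (.prompt p) (.throw (u.rename Fin.succ) (.val (.var 0))))

/-- `λz. throw prompt_p (v z)` -/
def promptFun (p : Prompt) {n : ℕ} (v : Val n) : Val n :=
  .lam (.throw (promptOp p) (.app (.val (v.rename Fin.succ)) (.val (.var 0))))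

/-- `λl. v (λz. throw prompt_p (l z))` -/
def wrapFun (p : Prompt) {n : ℕ} (v : Val n) : Val n :=
  .lam (.app (.val (v.rename Fin.succ)) (.val (promptFun p (.var 0))))

theorem throwFun_rename {m n : ℕ} (ρ : Fin m → Fin n) (u : Val m) :
    (throwFun u).rename ρ = throwFun (u.rename ρ) := by
  simp [throwFun, Val.rename, Expr.rename, Val.rename_succ_rename, liftRen]

theorem resumeFun_rename (p : Prompt) {m n : ℕ} (ρ : Fin m → Fin n) (u : Val m) :
    (resumeFun p u).rename ρ = resumeFun p (u.rename ρ) := by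
  simp [resumeFun, Val.rename, Expr.rename, Val.rename_succ_rename, liftRen]

theorem promptFun_rename (p : Prompt) {m n : ℕ} (ρ : Fin m → Fin n) (v : Val m) :
    (promptFun p v).rename ρ = promptFun p (v.rename ρ) := by
  simp [promptFun, promptOp, Val.rename, Expr.rename, ECtx.rename, Val.rename_succ_rename, liftRen]

theorem wrapFun_rename (p : Prompt) {m n : ℕ} (ρ : Fin m → Fin n) (v : Val m) :
    (wrapFun p v).rename ρ = wrapFun p (v.rename ρ) := by
  simp [wrapFun, promptFun_rename, Val.rename, Expr.rename, Val.rename_succ_rename, liftRen]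

theorem promptOp_rename (p : Prompt) {m n : ℕ} (ρ : Fin m → Fin n) :
    (promptOp p).rename ρ = promptOp p := by
  rfl

theorem shiftOp_rename (p : Prompt) {m n : ℕ} (ρ : Fin m → Fin n) :
    (shiftOp p).rename ρ = shiftOp p := by
  rfl

theorem controlOp_rename (p : Prompt) {m n : ℕ} (ρ : Fin m → Fin n) :
    (controlOp p).rename ρ = controlOp p := by
  rfl

theorem throwFun_subst {m n : ℕ} (σ : Fin m → Val n) (u : Val m) :
    (throwFun u).subst σ = throwFun (u.subst σ) := by
  simp [throwFun, Val.subst, Expr.subst, Val.rename_succ_subst, liftSub]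

theorem resumeFun_subst (p : Prompt) {m n : ℕ} (σ : Fin m → Val n) (u : Val m) :
    (resumeFun p u).subst σ = resumeFun p (u.subst σ) := by
  simp [resumeFun, Val.subst, Expr.subst, Val.rename_succ_subst, liftSub]

theorem promptFun_subst (p : Prompt) {m n : ℕ} (σ : Fin m → Val n) (v : Val m) :
    (promptFun p v).subst σ = promptFun p (v.subst σ) := by
  simp [promptFun, promptOp, Val.subst, Expr.subst, ECtx.subst, Val.rename_succ_subst, liftSub]

theorem wrapFun_subst (p : Prompt) {m n : ℕ} (σ : Fin m → Val n) (v : Val m) :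
    (wrapFun p v).subst σ = wrapFun p (v.subst σ) := by
  simp [wrapFun, promptFun_subst, Val.subst, Expr.subst, Val.rename_succ_subst, liftSub]

theorem promptOp_subst (p : Prompt) {m n : ℕ} (σ : Fin m → Val n) :
    (promptOp p).subst σ = promptOp p := by
  rfl

theorem shiftOp_subst (p : Prompt) {m n : ℕ} (σ : Fin m → Val n) :
    (shiftOp p).subst σ = shiftOp p := by
  rfl

theorem controlOp_subst (p : Prompt) {m n : ℕ} (σ : Fin m → Val n) :
    (controlOp p).subst σ = controlOp p := by
  rfl

mutual

/-- The compatible closure of the pairs of a term met when running `shift_p` and of one met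
when running its encoding with `control_p`. -/
inductive Expr.Sim (p : Prompt) : {n : ℕ} → Expr n → Expr n → Prop
  | val {n : ℕ} {v v' : Val n} (h : Val.Sim p v v') : Expr.Sim p (.val v) (.val v')
  | app {n : ℕ} {a a' b b' : Expr n} (h₁ : Expr.Sim p a a') (h₂ : Expr.Sim p b b') :
      Expr.Sim p (.app a b) (.app a' b')
  | fresh {n : ℕ} {e e' : Expr (n + 1)} (h : Expr.Sim p e e') : Expr.Sim p (.fresh e) (.fresh e')
  | reset {n : ℕ} {v v' : Val n} {e e' : Expr n} (h₁ : Val.Sim p v v') (h₂ : Expr.Sim p e e') :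
      Expr.Sim p (.reset v e) (.reset v' e')
  | grab {n : ℕ} {v v' : Val n} {e e' : Expr (n + 1)} (h₁ : Val.Sim p v v')
      (h₂ : Expr.Sim p e e') : Expr.Sim p (.grab v e) (.grab v' e')
  | throw {n : ℕ} {v v' : Val n} {e e' : Expr n} (h₁ : Val.Sim p v v') (h₂ : Expr.Sim p e e') :
      Expr.Sim p (.throw v e) (.throw v' e')
  | shiftApp {n : ℕ} {v v' : Val n} (h : Val.Sim p v v') :
      Expr.Sim p (.app (.val (shiftOp p)) (.val v))
        (.app (.val (controlOp p)) (.val (wrapFun p v')))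
  | appResume {n : ℕ} {v v' u u' : Val n} (h₁ : Val.Sim p v v') (h₂ : Val.Sim p u u') :
      Expr.Sim p (.app (.val v) (.val (resumeFun p u)))
        (.app (.val (wrapFun p v')) (.val (throwFun u')))
  | resumeApp {n : ℕ} {u u' w w' : Val n} (h₁ : Val.Sim p u u') (h₂ : Val.Sim p w w') :
      Expr.Sim p (.app (.val (resumeFun p u)) (.val w))
        (.throw (promptOp p) (.app (.val (throwFun u')) (.val w')))
  | throwApp {n : ℕ} {u u' w w' : Val n} (h₁ : Val.Sim p u u') (h₂ : Val.Sim p w w') :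
      Expr.Sim p (.throw u (.val w)) (.app (.val (throwFun u')) (.val w'))

inductive Val.Sim (p : Prompt) : {n : ℕ} → Val n → Val n → Prop
  | var {n : ℕ} (i : Fin n) : Val.Sim p (.var i) (.var i)
  | lam {n : ℕ} {e e' : Expr (n + 1)} (h : Expr.Sim p e e') : Val.Sim p (.lam e) (.lam e')
  | prompt {n : ℕ} (q : Prompt) : Val.Sim p (.prompt q : Val n) (.prompt q)
  | cont {n : ℕ} {E E' : ECtx n} (h : ECtx.Sim p E E') : Val.Sim p (.cont E) (.cont E')
  | shift {n : ℕ} : Val.Sim p (shiftOp p : Val n) (shiftOp' p)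
  | resume {n : ℕ} {u u' : Val n} (h : Val.Sim p u u') :
      Val.Sim p (resumeFun p u) (promptFun p (throwFun u'))

inductive ECtx.Sim (p : Prompt) : {n : ℕ} → ECtx n → ECtx n → Prop
  | hole {n : ℕ} : ECtx.Sim p (.hole : ECtx n) .hole
  | appL {n : ℕ} {E E' : ECtx n} {e e' : Expr n} (h₁ : ECtx.Sim p E E') (h₂ : Expr.Sim p e e') :
      ECtx.Sim p (.appL E e) (.appL E' e')
  | appR {n : ℕ} {v v' : Val n} {E E' : ECtx n} (h₁ : Val.Sim p v v') (h₂ : ECtx.Sim p E E') :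
      ECtx.Sim p (.appR v E) (.appR v' E')
  | reset {n : ℕ} (q : Prompt) {E E' : ECtx n} (h : ECtx.Sim p E E') :
      ECtx.Sim p (.reset q E) (.reset q E')

end

mutual

theorem Expr.Sim.rename {p : Prompt} {m n : ℕ} (ρ : Fin m → Fin n) {e e' : Expr m} :
    Expr.Sim p e e' → Expr.Sim p (e.rename ρ) (e'.rename ρ)
  | .val h => .val (h.rename ρ)
  | .app h₁ h₂ => .app (h₁.rename ρ) (h₂.rename ρ)
  | .fresh h => .fresh (h.rename (liftRen ρ))
  | .reset h₁ h₂ => .reset (h₁.rename ρ) (h₂.rename ρ)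
  | .grab h₁ h₂ => .grab (h₁.rename ρ) (h₂.rename (liftRen ρ))
  | .throw h₁ h₂ => .throw (h₁.rename ρ) (h₂.rename ρ)
  | .shiftApp h => by
      simpa only [Expr.rename, shiftOp_rename, controlOp_rename, wrapFun_rename]
        using Expr.Sim.shiftApp (h.rename ρ)
  | .appResume h₁ h₂ => by
      simpa only [Expr.rename, resumeFun_rename, throwFun_rename, wrapFun_rename]
        using Expr.Sim.appResume (h₁.rename ρ) (h₂.rename ρ)
  | .resumeApp h₁ h₂ => by
      simpa only [Expr.rename, resumeFun_rename, throwFun_rename, promptOp_rename]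
        using Expr.Sim.resumeApp (h₁.rename ρ) (h₂.rename ρ)
  | .throwApp h₁ h₂ => by
      simpa only [Expr.rename, throwFun_rename]
        using Expr.Sim.throwApp (h₁.rename ρ) (h₂.rename ρ)

theorem Val.Sim.rename {p : Prompt} {m n : ℕ} (ρ : Fin m → Fin n) {v v' : Val m} :
    Val.Sim p v v' → Val.Sim p (v.rename ρ) (v'.rename ρ)
  | .var i => .var (ρ i)
  | .lam h => .lam (h.rename (liftRen ρ))
  | .prompt q => .prompt q
  | .cont h => .cont (h.rename ρ)
  | .shift => .shift
  | .resume h => by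
      simpa only [resumeFun_rename, promptFun_rename, throwFun_rename]
        using Val.Sim.resume (h.rename ρ)

theorem ECtx.Sim.rename {p : Prompt} {m n : ℕ} (ρ : Fin m → Fin n) {E E' : ECtx m} :
    ECtx.Sim p E E' → ECtx.Sim p (E.rename ρ) (E'.rename ρ)
  | .hole => .hole
  | .appL h₁ h₂ => .appL (h₁.rename ρ) (h₂.rename ρ)
  | .appR h₁ h₂ => .appR (h₁.rename ρ) (h₂.rename ρ)
  | .reset q h => .reset q (h.rename ρ)

end

theorem liftSub_sim {p : Prompt} {m n : ℕ} {σ σ' : Fin m → Val n}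
    (hσ : ∀ i, Val.Sim p (σ i) (σ' i)) (i : Fin (m + 1)) :
    Val.Sim p (liftSub σ i) (liftSub σ' i) := by
  refine Fin.cases ?_ (fun i => ?_) i
  · exact .var 0
  · exact (hσ i).rename Fin.succ

mutual

theorem Expr.Sim.subst {p : Prompt} {m n : ℕ} {σ σ' : Fin m → Val n}
    (hσ : ∀ i, Val.Sim p (σ i) (σ' i)) {e e' : Expr m} :
    Expr.Sim p e e' → Expr.Sim p (e.subst σ) (e'.subst σ')
  | .val h => .val (h.subst hσ)
  | .app h₁ h₂ => .app (h₁.subst hσ) (h₂.subst hσ)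
  | .fresh h => .fresh (h.subst (liftSub_sim hσ))
  | .reset h₁ h₂ => .reset (h₁.subst hσ) (h₂.subst hσ)
  | .grab h₁ h₂ => .grab (h₁.subst hσ) (h₂.subst (liftSub_sim hσ))
  | .throw h₁ h₂ => .throw (h₁.subst hσ) (h₂.subst hσ)
  | .shiftApp h => by
      simpa only [Expr.subst, shiftOp_subst, controlOp_subst, wrapFun_subst]
        using Expr.Sim.shiftApp (h.subst hσ)
  | .appResume h₁ h₂ => by
      simpa only [Expr.subst, resumeFun_subst, throwFun_subst, wrapFun_subst]
        using Expr.Sim.appResume (h₁.subst hσ) (h₂.subst hσ)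
  | .resumeApp h₁ h₂ => by
      simpa only [Expr.subst, resumeFun_subst, throwFun_subst, promptOp_subst]
        using Expr.Sim.resumeApp (h₁.subst hσ) (h₂.subst hσ)
  | .throwApp h₁ h₂ => by
      simpa only [Expr.subst, throwFun_subst]
        using Expr.Sim.throwApp (h₁.subst hσ) (h₂.subst hσ)

theorem Val.Sim.subst {p : Prompt} {m n : ℕ} {σ σ' : Fin m → Val n}
    (hσ : ∀ i, Val.Sim p (σ i) (σ' i)) {v v' : Val m} :
    Val.Sim p v v' → Val.Sim p (v.subst σ) (v'.subst σ')
  | .var i => hσ i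
  | .lam h => .lam (h.subst (liftSub_sim hσ))
  | .prompt q => .prompt q
  | .cont h => .cont (h.subst hσ)
  | .shift => .shift
  | .resume h => by
      simpa only [resumeFun_subst, promptFun_subst, throwFun_subst]
        using Val.Sim.resume (h.subst hσ)

theorem ECtx.Sim.subst {p : Prompt} {m n : ℕ} {σ σ' : Fin m → Val n}
    (hσ : ∀ i, Val.Sim p (σ i) (σ' i)) {E E' : ECtx m} :
    ECtx.Sim p E E' → ECtx.Sim p (E.subst σ) (E'.subst σ')
  | .hole => .hole
  | .appL h₁ h₂ => .appL (h₁.subst hσ) (h₂.subst hσ)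
  | .appR h₁ h₂ => .appR (h₁.subst hσ) (h₂.subst hσ)
  | .reset q h => .reset q (h.subst hσ)

end

theorem Expr.Sim.inst {p : Prompt} {n : ℕ} {e e' : Expr (n + 1)} {v v' : Val n}
    (he : Expr.Sim p e e') (hv : Val.Sim p v v') : Expr.Sim p (e.inst v) (e'.inst v') := by
  refine he.subst (fun i => ?_)
  refine Fin.cases ?_ (fun i => ?_) i
  · exact hv
  · exact .var i

mutual

theorem Expr.Sim.prompts_eq {p : Prompt} {n : ℕ} {e e' : Expr n} :
    Expr.Sim p e e' → e.prompts = e'.prompts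
  | .val h => h.prompts_eq
  | .app h₁ h₂ => by simp only [Expr.prompts, h₁.prompts_eq, h₂.prompts_eq]
  | .fresh h => h.prompts_eq
  | .reset h₁ h₂ => by simp only [Expr.prompts, h₁.prompts_eq, h₂.prompts_eq]
  | .grab h₁ h₂ => by simp only [Expr.prompts, h₁.prompts_eq, h₂.prompts_eq]
  | .throw h₁ h₂ => by simp only [Expr.prompts, h₁.prompts_eq, h₂.prompts_eq]
  | .shiftApp h => by
      ext q
      simp [Expr.prompts, Val.prompts, ECtx.prompts, shiftOp, controlOp, wrapFun, promptFun,
        promptOp, Val.rename, Val.prompts_rename, h.prompts_eq]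
  | .appResume h₁ h₂ => by
      ext q
      simp [Expr.prompts, Val.prompts, ECtx.prompts, resumeFun, throwFun, wrapFun, promptFun,
        promptOp, Val.rename, Val.prompts_rename, h₁.prompts_eq, h₂.prompts_eq]
  | .resumeApp h₁ h₂ => by
      ext q
      simp [Expr.prompts, Val.prompts, ECtx.prompts, resumeFun, throwFun, promptOp,
        Val.prompts_rename, h₁.prompts_eq, h₂.prompts_eq]
  | .throwApp h₁ h₂ => by
      simp [Expr.prompts, Val.prompts, throwFun, Val.prompts_rename, h₁.prompts_eq,
        h₂.prompts_eq]

theorem Val.Sim.prompts_eq {p : Prompt} {n : ℕ} {v v' : Val n} :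
    Val.Sim p v v' → v.prompts = v'.prompts
  | .var i => rfl
  | .lam h => h.prompts_eq
  | .prompt q => rfl
  | .cont h => h.prompts_eq
  | .shift => by
      ext q
      simp [Expr.prompts, Val.prompts, ECtx.prompts, shiftOp, shiftOp', controlOp, promptOp]
  | .resume h => by
      simp [Expr.prompts, Val.prompts, ECtx.prompts, resumeFun, throwFun, promptFun,
        promptOp, Val.prompts_rename, h.prompts_eq]

theorem ECtx.Sim.prompts_eq {p : Prompt} {n : ℕ} {E E' : ECtx n} :
    ECtx.Sim p E E' → E.prompts = E'.prompts
  | .hole => rfl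
  | .appL h₁ h₂ => by simp only [ECtx.prompts, h₁.prompts_eq, h₂.prompts_eq]
  | .appR h₁ h₂ => by simp only [ECtx.prompts, h₁.prompts_eq, h₂.prompts_eq]
  | .reset q h => by simp only [ECtx.prompts, h.prompts_eq]

end

/-! ## Head reduction -/

/-- The reduction steps whose redex is the whole expression. -/
inductive Head {n : ℕ} : Expr n → Expr n → Prop
  | beta (e : Expr (n + 1)) (v : Val n) : Head (.app (.val (.lam e)) (.val v)) (e.inst v)
  | resetVal (p : Prompt) (v : Val n) : Head (.reset (.prompt p) (.val v)) (.val v)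
  | grab (p : Prompt) (E : ECtx n) (e : Expr (n + 1)) (hp : p ∉ E.surr) :
      Head (.reset (.prompt p) (E.plug (.grab (.prompt p) e))) (e.inst (.cont E))
  | throw (E : ECtx n) (e : Expr n) : Head (.throw (.cont E) e) (E.plug e)
  | fresh (e : Expr (n + 1)) (p : Prompt) (hp : p ∉ e.prompts) :
      Head (.fresh e) (e.inst (.prompt p))

/-- `E.comp D` is `E` with its hole filled with `D`. -/
def ECtx.comp {n : ℕ} : ECtx n → ECtx n → ECtx n
  | .hole, D => D
  | .appL E e, D => .appL (E.comp D) e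
  | .appR v E, D => .appR v (E.comp D)
  | .reset p E, D => .reset p (E.comp D)

theorem ECtx.plug_comp {n : ℕ} (E D : ECtx n) (e : Expr n) :
    (E.comp D).plug e = E.plug (D.plug e) := by
  match E with
  | .hole => rfl
  | .appL E _ | .appR _ E | .reset _ E => simp only [ECtx.comp, ECtx.plug, ECtx.plug_comp E D e]

theorem ECtx.prompts_comp {n : ℕ} (E D : ECtx n) :
    (E.comp D).prompts = E.prompts ∪ D.prompts := by
  match E with
  | .hole => simp [ECtx.comp, ECtx.prompts]
  | .appL E _ | .appR _ E | .reset _ E =>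
      ext q
      simp only [ECtx.comp, ECtx.prompts, ECtx.prompts_comp E D, Finset.mem_union]
      tauto

theorem ECtx.prompts_plug {n : ℕ} (E : ECtx n) (e : Expr n) :
    (E.plug e).prompts = E.prompts ∪ e.prompts := by
  match E with
  | .hole => simp [ECtx.plug, ECtx.prompts]
  | .appL E _ | .appR _ E | .reset _ E =>
      ext q
      simp only [ECtx.plug, Expr.prompts, Val.prompts, ECtx.prompts, ECtx.prompts_plug E e,
        Finset.mem_union]
      tauto

theorem promptsFresh_iff {A B C : Finset Prompt} :
    PromptsFresh A B C ↔ ∀ q ∈ A, q ∈ C → q ∈ B := by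
  simp only [PromptsFresh, Finset.ext_iff, Finset.mem_inter, Finset.mem_sdiff,
    Finset.notMem_empty, iff_false]
  exact ⟨fun h q ha hc => by_contra fun hb => h q ⟨⟨ha, hb⟩, hc⟩,
    fun h q hq => hq.1.2 (h q hq.1.1 hq.2)⟩

theorem PromptsFresh.of_eq {A B C : Finset Prompt} (h : A = B) : PromptsFresh A B C :=
  promptsFresh_iff.2 fun _ ha _ => h ▸ ha

theorem Head.red {n : ℕ} {e e' : Expr n} (h : Head e e') : Red e e' := by
  cases h with
  | beta e v => exact .beta e v
  | resetVal q v => exact .resetVal q v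
  | grab q E e hq => exact .grab q E e hq
  | throw E e => exact .throw E e
  | fresh e q hq => exact .fresh e q hq

theorem red_iff_head {n : ℕ} {e e' : Expr n} :
    Red e e' ↔ ∃ (E : ECtx n) (r s : Expr n), Head r s ∧
      PromptsFresh s.prompts r.prompts E.prompts ∧ e = E.plug r ∧ e' = E.plug s := by
  constructor
  · have whole : ∀ {e e' : Expr n}, Head e e' →
        ∃ (E : ECtx n) (r s : Expr n), Head r s ∧ PromptsFresh s.prompts r.prompts E.prompts ∧
          e = E.plug r ∧ e' = E.plug s := fun {e e'} h =>
      ⟨.hole, e, e', h, promptsFresh_iff.2 (by simp [ECtx.prompts]), rfl, rfl⟩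
    intro h
    induction h with
    | beta e v => exact whole (.beta e v)
    | resetVal q v => exact whole (.resetVal q v)
    | grab q E e hq => exact whole (.grab q E e hq)
    | throw E e => exact whole (.throw E e)
    | fresh e q hq => exact whole (.fresh e q hq)
    | compat D e₁ e₂ _ hf ih =>
      obtain ⟨E, r, s, hrs, hfr, rfl, rfl⟩ := ih
      refine ⟨D.comp E, r, s, hrs, ?_, (D.plug_comp E r).symm, (D.plug_comp E s).symm⟩
      rw [promptsFresh_iff] at hf hfr ⊢
      simp only [ECtx.prompts_plug, ECtx.prompts_comp, Finset.mem_union] at hf hfr ⊢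
      intro q hs hq
      rcases hq with hq | hq
      · rcases hf q (.inr hs) hq with h | h
        · exact hfr q hs h
        · exact h
      · exact hfr q hs hq
  · rintro ⟨E, r, s, hrs, hf, rfl, rfl⟩
    exact .compat E r s hrs.red hf

theorem Head.not_isVal {n : ℕ} {e e' : Expr n} (h : Head e e') : ¬ e.IsVal := by
  rintro ⟨v, rfl⟩
  cases h

theorem ECtx.not_isVal_plug {n : ℕ} {E : ECtx n} {e : Expr n} (h : ¬ e.IsVal) :
    ¬ (E.plug e).IsVal := by
  cases E with
  | hole => exact h
  | _ => rintro ⟨v, hv⟩; cases hv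

theorem not_isVal_grab {n : ℕ} (v : Val n) (b : Expr (n + 1)) : ¬ (Expr.grab v b).IsVal := by
  rintro ⟨w, hw⟩
  cases hw

/-! ## Evaluation positions of related expressions -/

theorem ECtx.Sim.plug {p : Prompt} {n : ℕ} {E E' : ECtx n} {e e' : Expr n}
    (hE : ECtx.Sim p E E') (he : Expr.Sim p e e') : Expr.Sim p (E.plug e) (E'.plug e') := by
  match hE with
  | .hole => exact he
  | .appL h₁ h₂ => exact .app (h₁.plug he) h₂
  | .appR h₁ h₂ => exact .app (.val h₁) (h₂.plug he)
  | .reset q h => exact .reset (.prompt q) (h.plug he)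

theorem ECtx.Sim.comp {p : Prompt} {n : ℕ} {E E' D D' : ECtx n}
    (hE : ECtx.Sim p E E') (hD : ECtx.Sim p D D') : ECtx.Sim p (E.comp D) (E'.comp D') := by
  match hE with
  | .hole => exact hD
  | .appL h₁ h₂ => exact .appL (h₁.comp hD) h₂
  | .appR h₁ h₂ => exact .appR h₁ (h₂.comp hD)
  | .reset q h => exact .reset q (h.comp hD)

theorem ECtx.Sim.surr_eq {p : Prompt} {n : ℕ} {E E' : ECtx n} (h : ECtx.Sim p E E') :
    E.surr = E'.surr := by
  match h with
  | .hole => rfl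
  | .appL h _ => exact h.surr_eq
  | .appR _ h => exact h.surr_eq
  | .reset q h => simp only [ECtx.surr, h.surr_eq]

theorem Expr.Sim.isVal_iff {p : Prompt} {n : ℕ} {e e' : Expr n} (h : Expr.Sim p e e') :
    e.IsVal ↔ e'.IsVal := by
  constructor
  · rintro ⟨v, rfl⟩
    cases h with
    | val h => exact ⟨_, rfl⟩
  · rintro ⟨v, rfl⟩
    cases h with
    | val h => exact ⟨_, rfl⟩

theorem Expr.Sim.plug_left {p : Prompt} {n : ℕ} {E : ECtx n} {r e' : Expr n} (hr : ¬ r.IsVal)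
    (h : Expr.Sim p (E.plug r) e') :
    ∃ E' r', e' = E'.plug r' ∧ ECtx.Sim p E E' ∧ Expr.Sim p r r' := by
  match E with
  | .hole => exact ⟨.hole, e', rfl, .hole, h⟩
  | .appL E a =>
    simp only [ECtx.plug] at h
    generalize hx : E.plug r = x at h
    have hv : ¬ x.IsVal := hx ▸ ECtx.not_isVal_plug hr
    cases h with
    | app h₁ h₂ =>
      obtain ⟨E', r', rfl, hE, hr'⟩ := Expr.Sim.plug_left hr (hx ▸ h₁)
      exact ⟨.appL E' _, r', rfl, .appL hE h₂, hr'⟩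
    | shiftApp _ | appResume _ _ | resumeApp _ _ => exact absurd ⟨_, rfl⟩ hv
  | .appR v E =>
    simp only [ECtx.plug] at h
    generalize hx : E.plug r = x at h
    have hv : ¬ x.IsVal := hx ▸ ECtx.not_isVal_plug hr
    cases h with
    | app h₁ h₂ =>
      obtain ⟨E', r', rfl, hE, hr'⟩ := Expr.Sim.plug_left hr (hx ▸ h₂)
      cases h₁ with
      | val h₁ => exact ⟨.appR _ E', r', rfl, .appR h₁ hE, hr'⟩
    | shiftApp _ | appResume _ _ | resumeApp _ _ => exact absurd ⟨_, rfl⟩ hv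
  | .reset q E =>
    simp only [ECtx.plug] at h
    cases h with
    | reset h₁ h₂ =>
      obtain ⟨E', r', rfl, hE, hr'⟩ := Expr.Sim.plug_left hr h₂
      cases h₁ with
      | prompt => exact ⟨.reset q E', r', rfl, .reset q hE, hr'⟩

theorem Expr.Sim.plug_right {p : Prompt} {n : ℕ} {E' : ECtx n} {e r' : Expr n}
    (hr : ¬ r'.IsVal) (h : Expr.Sim p e (E'.plug r')) :
    ∃ E r, e = E.plug r ∧ ECtx.Sim p E E' ∧ Expr.Sim p r r' := by
  match E' with
  | .hole => exact ⟨.hole, e, rfl, .hole, h⟩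
  | .appL E a =>
    simp only [ECtx.plug] at h
    generalize hx : E.plug r' = x at h
    have hv : ¬ x.IsVal := hx ▸ ECtx.not_isVal_plug hr
    cases h with
    | app h₁ h₂ =>
      obtain ⟨E', r', rfl, hE, hr'⟩ := Expr.Sim.plug_right hr (hx ▸ h₁)
      exact ⟨.appL E' _, r', rfl, .appL hE h₂, hr'⟩
    | shiftApp _ | appResume _ _ | throwApp _ _ => exact absurd ⟨_, rfl⟩ hv
  | .appR v E =>
    simp only [ECtx.plug] at h
    generalize hx : E.plug r' = x at h
    have hv : ¬ x.IsVal := hx ▸ ECtx.not_isVal_plug hr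
    cases h with
    | app h₁ h₂ =>
      obtain ⟨E', r', rfl, hE, hr'⟩ := Expr.Sim.plug_right hr (hx ▸ h₂)
      cases h₁ with
      | val h₁ => exact ⟨.appR _ E', r', rfl, .appR h₁ hE, hr'⟩
    | shiftApp _ | appResume _ _ | throwApp _ _ => exact absurd ⟨_, rfl⟩ hv
  | .reset q E =>
    simp only [ECtx.plug] at h
    cases h with
    | reset h₁ h₂ =>
      obtain ⟨E', r', rfl, hE, hr'⟩ := Expr.Sim.plug_right hr h₂
      cases h₁ with
      | prompt => exact ⟨.reset q E', r', rfl, .reset q hE, hr'⟩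

/-! ## Head steps of related expressions -/

theorem head_shiftOp (p : Prompt) {n : ℕ} (v : Val n) :
    Head (.app (.val (shiftOp p)) (.val v))
      (.grab (.prompt p) (.reset (.prompt p)
        (.app (.val (v.rename Fin.succ)) (.val (resumeFun p (.var 0)))))) :=
  .beta _ v

theorem head_shiftOp' (p : Prompt) {n : ℕ} (v : Val n) :
    Head (.app (.val (shiftOp' p)) (.val v))
      (.app (.val (controlOp p)) (.val (wrapFun p v))) :=
  .beta _ v

theorem head_controlOp (p : Prompt) {n : ℕ} (v : Val n) :
    Head (.app (.val (controlOp p)) (.val v))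
      (.grab (.prompt p) (.reset (.prompt p)
        (.app (.val (v.rename Fin.succ)) (.val (throwFun (.var 0)))))) :=
  .beta _ v

theorem head_resumeFun (p : Prompt) {n : ℕ} (u w : Val n) :
    Head (.app (.val (resumeFun p u)) (.val w)) (.reset (.prompt p) (.throw u (.val w))) := by
  have h := Head.beta (.reset (.prompt p) (.throw (u.rename Fin.succ) (.val (.var 0)))) w
  simpa only [resumeFun, Expr.inst, Expr.subst, Val.subst, Val.rename_succ_inst,
    Fin.cases_zero] using h

theorem head_promptFun (p : Prompt) {n : ℕ} (v w : Val n) :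
    Head (.app (.val (promptFun p v)) (.val w))
      (.throw (promptOp p) (.app (.val v) (.val w))) := by
  have h := Head.beta
    (.throw (promptOp p) (.app (.val (v.rename Fin.succ)) (.val (.var 0)))) w
  simpa only [promptFun, Expr.inst, Expr.subst, Val.subst, Val.rename_succ_inst, Fin.cases_zero,
    promptOp_subst] using h

theorem head_throwFun {n : ℕ} (u w : Val n) :
    Head (.app (.val (throwFun u)) (.val w)) (.throw u (.val w)) := by
  have h := Head.beta (.throw (u.rename Fin.succ) (.val (.var 0))) w
  simpa only [throwFun, Expr.inst, Expr.subst, Val.subst, Val.rename_succ_inst,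
    Fin.cases_zero] using h

theorem head_wrapFun (p : Prompt) {n : ℕ} (v w : Val n) :
    Head (.app (.val (wrapFun p v)) (.val w)) (.app (.val v) (.val (promptFun p w))) := by
  have h := Head.beta (.app (.val (v.rename Fin.succ)) (.val (promptFun p (.var 0)))) w
  simpa only [wrapFun, Expr.inst, Expr.subst, Val.subst, Val.rename_succ_inst, Fin.cases_zero,
    promptFun_subst] using h

theorem head_promptOp (p : Prompt) {n : ℕ} (e : Expr n) :
    Head (.throw (promptOp p) e) (.reset (.prompt p) e) :=
  .throw (.reset p .hole) e

theorem Head.beta_eq {n : ℕ} {b : Expr (n + 1)} {v s s' : Expr n}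
    (h : Head (.app (.val (.lam b)) v) s) (h' : Head (.app (.val (.lam b)) v) s') : s = s' := by
  cases h; cases h'; rfl

theorem Head.throw_eq {n : ℕ} {v : Val n} {e s s' : Expr n}
    (h : Head (.throw v e) s) (h' : Head (.throw v e) s') : s = s' := by
  cases h; cases h'; rfl

/-- A head step of the second expression that keeps it related to `e`. -/
def AdminStep (p : Prompt) {n : ℕ} (e a b : Expr n) : Prop :=
  Head a b ∧ Expr.Sim p e a ∧ Expr.Sim p e b

theorem sim_grab_body {p : Prompt} {n : ℕ} {v v' : Val n} (h : Val.Sim p v v') :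
    Expr.Sim p
      (.grab (.prompt p) (.reset (.prompt p)
        (.app (.val (v.rename Fin.succ)) (.val (resumeFun p (.var 0))))))
      (.grab (.prompt p) (.reset (.prompt p)
        (.app (.val ((wrapFun p v').rename Fin.succ)) (.val (throwFun (.var 0)))))) := by
  rw [wrapFun_rename]
  exact .grab (.prompt p) (.reset (.prompt p) (.appResume (h.rename _) (.var 0)))

theorem sim_reset_throw {p : Prompt} {n : ℕ} {u u' w w' : Val n} (hu : Val.Sim p u u')
    (hw : Val.Sim p w w') :
    Expr.Sim p (.reset (.prompt p) (.throw u (.val w)))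
      (.reset (.prompt p) (.app (.val (throwFun u')) (.val w'))) :=
  .reset (.prompt p) (.throwApp hu hw)

theorem Val.Sim.head_app {p : Prompt} {n : ℕ} {v v' w w' : Val n} {s : Expr n}
    (hv : Val.Sim p v v') (hw : Val.Sim p w w') (hs : Head (.app (.val v) (.val w)) s) :
    ∃ m s', Relation.ReflTransGen (AdminStep p (.app (.val v) (.val w)))
      (.app (.val v') (.val w')) m ∧ Expr.Sim p (.app (.val v) (.val w)) m ∧
      Head m s' ∧ Expr.Sim p s s' := by
  have h₀ := Expr.Sim.app (.val hv) (.val hw)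
  cases hv with
  | var | prompt | cont => cases hs
  | lam h =>
    cases hs with
    | beta => exact ⟨_, _, .refl, h₀, .beta _ _, h.inst hw⟩
  | shift =>
    have h₁ := Expr.Sim.shiftApp hw
    obtain rfl := hs.beta_eq (head_shiftOp p w)
    exact ⟨_, _, .single ⟨head_shiftOp' p w', h₀, h₁⟩, h₁, head_controlOp p _,
      sim_grab_body hw⟩
  | resume hu =>
    have h₁ := Expr.Sim.resumeApp hu hw
    obtain rfl := hs.beta_eq (head_resumeFun p _ w)
    exact ⟨_, _, .single ⟨head_promptFun p _ w', h₀, h₁⟩, h₁, head_promptOp p _,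
      sim_reset_throw hu hw⟩

theorem Val.Sim.head_throw {p : Prompt} {n : ℕ} {v v' : Val n} {e e' s : Expr n}
    (hv : Val.Sim p v v') (he : Expr.Sim p e e') (hs : Head (.throw v e) s) :
    ∃ s', Head (.throw v' e') s' ∧ Expr.Sim p s s' := by
  cases hs with
  | throw E =>
    cases hv with
    | cont hE => exact ⟨_, .throw _ _, hE.plug he⟩

theorem Val.Sim.head_throw' {p : Prompt} {n : ℕ} {v v' : Val n} {e e' s' : Expr n}
    (hv : Val.Sim p v v') (he : Expr.Sim p e e') (hs : Head (.throw v' e') s') :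
    ∃ s, Head (.throw v e) s ∧ Expr.Sim p s s' := by
  cases hs with
  | throw E =>
    cases hv with
    | cont hE => exact ⟨_, .throw _ _, hE.plug he⟩

theorem Expr.Sim.head_left {p : Prompt} {n : ℕ} {r r' s : Expr n} (h : Expr.Sim p r r')
    (hs : Head r s) :
    ∃ m s', Relation.ReflTransGen (AdminStep p r) r' m ∧ Expr.Sim p r m ∧
      Head m s' ∧ Expr.Sim p s s' := by
  have h₀ := h
  cases h with
  | val | grab => cases hs
  | app h₁ h₂ =>
    cases hs with
    | beta b v =>
      cases h₁ with
      | val h₁ =>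
        cases h₂ with
        | val h₂ => exact h₁.head_app h₂ (.beta b v)
  | fresh h =>
    cases hs with
    | fresh b q hq =>
      exact ⟨_, _, .refl, h₀, .fresh _ q (h.prompts_eq ▸ hq), h.inst (.prompt q)⟩
  | reset h₁ h₂ =>
    cases hs with
    | resetVal q v =>
      cases h₁ with
      | prompt =>
        cases h₂ with
        | val h₂ => exact ⟨_, _, .refl, h₀, .resetVal q _, .val h₂⟩
    | grab q E b hq =>
      cases h₁ with
      | prompt =>
        obtain ⟨E', r', rfl, hE, hr⟩ := h₂.plug_left (not_isVal_grab _ b)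
        cases hr with
        | grab h₃ h₄ =>
          cases h₃ with
          | prompt =>
            exact ⟨_, _, .refl, h₀, .grab q E' _ (hE.surr_eq ▸ hq), h₄.inst (.cont hE)⟩
  | throw h₁ h₂ =>
    obtain ⟨s', hs', h⟩ := h₁.head_throw h₂ hs
    exact ⟨_, s', .refl, h₀, hs', h⟩
  | shiftApp h =>
    obtain rfl := hs.beta_eq (head_shiftOp p _)
    exact ⟨_, _, .refl, h₀, head_controlOp p _, sim_grab_body h⟩
  | appResume h₁ h₂ =>
    have h₃ := Val.Sim.resume h₂
    obtain ⟨m, s', hm, h⟩ := h₁.head_app h₃ hs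
    exact ⟨m, s', .head ⟨head_wrapFun p _ _, h₀, .app (.val h₁) (.val h₃)⟩ hm, h⟩
  | resumeApp h₁ h₂ =>
    obtain rfl := hs.beta_eq (head_resumeFun p _ _)
    exact ⟨_, _, .refl, h₀, head_promptOp p _, sim_reset_throw h₁ h₂⟩
  | throwApp h₁ h₂ =>
    have h₃ := Expr.Sim.throw h₁ (.val h₂)
    obtain ⟨s', hs', h⟩ := h₁.head_throw (.val h₂) hs
    exact ⟨_, s', .single ⟨head_throwFun _ _, h₀, h₃⟩, h₃, hs', h⟩

theorem Expr.Sim.head_right {p : Prompt} {n : ℕ} {r r' s' : Expr n} (h : Expr.Sim p r r')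
    (hs : Head r' s') : Expr.Sim p r s' ∨ ∃ s, Head r s ∧ Expr.Sim p s s' := by
  cases h with
  | val | grab => cases hs
  | app h₁ h₂ =>
    cases hs with
    | beta b v =>
      generalize hx : Val.lam b = x at h₁
      cases h₁ with
      | val h₁ =>
      cases h₂ with
      | val h₂ =>
      cases h₁ with
      | var | prompt | cont => cases hx
      | lam h =>
        cases hx
        exact .inr ⟨_, .beta _ _, h.inst h₂⟩
      | shift =>
        have hs := hx ▸ Head.beta b v
        obtain h := hs.beta_eq (head_shiftOp' p v)
        rw [h]
        exact .inl (.shiftApp h₂)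
      | resume h =>
        have hs := hx ▸ Head.beta b v
        obtain h' := hs.beta_eq (head_promptFun p _ v)
        rw [h']
        exact .inl (.resumeApp h h₂)
  | fresh h =>
    cases hs with
    | fresh b q hq => exact .inr ⟨_, .fresh _ q (h.prompts_eq ▸ hq), h.inst (.prompt q)⟩
  | reset h₁ h₂ =>
    cases hs with
    | resetVal q v =>
      cases h₁ with
      | prompt =>
        cases h₂ with
        | val h₂ => exact .inr ⟨_, .resetVal q _, .val h₂⟩
    | grab q E' b hq =>
      cases h₁ with
      | prompt =>
        obtain ⟨E, r, rfl, hE, hr⟩ := h₂.plug_right (not_isVal_grab _ b)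
        cases hr with
        | grab h₃ h₄ =>
          cases h₃ with
          | prompt =>
            exact .inr ⟨_, .grab q E _ (hE.surr_eq ▸ hq), h₄.inst (.cont hE)⟩
  | throw h₁ h₂ => exact .inr (h₁.head_throw' h₂ hs)
  | shiftApp h =>
    obtain rfl := hs.beta_eq (head_controlOp p _)
    exact .inr ⟨_, head_shiftOp p _, sim_grab_body h⟩
  | appResume h₁ h₂ =>
    obtain rfl := hs.beta_eq (head_wrapFun p _ _)
    exact .inl (.app (.val h₁) (.val (.resume h₂)))
  | resumeApp h₁ h₂ =>
    obtain rfl := hs.throw_eq (head_promptOp p _)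
    exact .inr ⟨_, head_resumeFun p _ _, sim_reset_throw h₁ h₂⟩
  | throwApp h₁ h₂ =>
    obtain rfl := hs.beta_eq (head_throwFun _ _)
    exact .inl (.throw h₁ (.val h₂))

/-! ## Capture under an evaluation context -/

theorem ECtx.plug_grab_inj {n : ℕ} {v w : Val n} {a b : Expr (n + 1)} {E D : ECtx n}
    (h : E.plug (.grab v a) = D.plug (.grab w b)) : E = D ∧ v = w ∧ a = b := by
  have hE := fun (F : ECtx n) => F.not_isVal_plug (not_isVal_grab v a)
  have hD := fun (F : ECtx n) => F.not_isVal_plug (not_isVal_grab w b)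
  match E, D with
  | .hole, .hole => cases h; exact ⟨rfl, rfl, rfl⟩
  | .appL E _, .appL D _ =>
    simp only [ECtx.plug, Expr.app.injEq] at h
    obtain ⟨rfl, h⟩ := ECtx.plug_grab_inj h.1
    simp_all
  | .appR _ E, .appR _ D =>
    simp only [ECtx.plug, Expr.app.injEq, Expr.val.injEq] at h
    obtain ⟨rfl, h⟩ := ECtx.plug_grab_inj h.2
    simp_all
  | .reset _ E, .reset _ D =>
    simp only [ECtx.plug, Expr.reset.injEq, Val.prompt.injEq] at h
    obtain ⟨rfl, h⟩ := ECtx.plug_grab_inj h.2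
    simp_all
  | .appL E _, .appR _ D =>
    simp only [ECtx.plug, Expr.app.injEq] at h
    exact absurd ⟨_, h.1⟩ (hE E)
  | .appR _ E, .appL D _ =>
    simp only [ECtx.plug, Expr.app.injEq] at h
    exact absurd ⟨_, h.1.symm⟩ (hD D)
  | .hole, .appL _ _ | .hole, .appR _ _ | .hole, .reset _ _ | .appL _ _, .hole
  | .appR _ _, .hole | .reset _ _, .hole | .appL _ _, .reset _ _ | .appR _ _, .reset _ _
  | .reset _ _, .appL _ _ | .reset _ _, .appR _ _ => cases h

theorem Head.eq_of_plug_grab {n : ℕ} {p : Prompt} {b : Expr (n + 1)} {H : ECtx n} {s : Expr n}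
    (h : Head (H.plug (.grab (.prompt p) b)) s) :
    ∃ D, H = .reset p D ∧ p ∉ D.surr ∧ s = b.inst (.cont D) := by
  have hv := fun (F : ECtx n) => F.not_isVal_plug (not_isVal_grab (.prompt p) b)
  match H with
  | .hole => cases h
  | .appL E e =>
    simp only [ECtx.plug] at h
    generalize hx : E.plug _ = x at h
    cases h with
    | beta => exact absurd ⟨_, hx⟩ (hv E)
  | .appR v E =>
    simp only [ECtx.plug] at h
    generalize hx : E.plug _ = x at h
    cases h with
    | beta => exact absurd ⟨_, hx⟩ (hv E)
  | .reset q E =>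
    simp only [ECtx.plug] at h
    generalize hx : E.plug _ = x at h
    cases h with
    | resetVal => exact absurd ⟨_, hx⟩ (hv E)
    | grab _ D e hq =>
      obtain ⟨rfl, hp, rfl⟩ := ECtx.plug_grab_inj hx
      cases hp
      exact ⟨E, rfl, hq, rfl⟩

theorem plug_eq_plug_grab {n : ℕ} {v : Val n} {b : Expr (n + 1)} {E H : ECtx n} {r s : Expr n}
    (hr : Head r s) (h : H.plug (.grab v b) = E.plug r) :
    ∃ D, H = E.comp D ∧ r = D.plug (.grab v b) := by
  have hv := fun (F : ECtx n) => F.not_isVal_plug (not_isVal_grab v b)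
  have hw := fun (F : ECtx n) => F.not_isVal_plug hr.not_isVal
  match E, H with
  | .hole, H => exact ⟨H, rfl, h.symm⟩
  | .appL E _, .appL H _ =>
    simp only [ECtx.plug, Expr.app.injEq] at h
    obtain ⟨D, rfl, hD⟩ := plug_eq_plug_grab hr h.1
    exact ⟨D, by rw [h.2]; rfl, hD⟩
  | .appR _ E, .appR _ H =>
    simp only [ECtx.plug, Expr.app.injEq, Expr.val.injEq] at h
    obtain ⟨D, rfl, hD⟩ := plug_eq_plug_grab hr h.2
    exact ⟨D, by rw [h.1]; rfl, hD⟩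
  | .reset _ E, .reset _ H =>
    simp only [ECtx.plug, Expr.reset.injEq, Val.prompt.injEq] at h
    obtain ⟨D, rfl, hD⟩ := plug_eq_plug_grab hr h.2
    exact ⟨D, by rw [h.1]; rfl, hD⟩
  | .appL E _, .appR _ H =>
    simp only [ECtx.plug, Expr.app.injEq] at h
    exact absurd ⟨_, h.1.symm⟩ (hw E)
  | .appR _ E, .appL H _ =>
    simp only [ECtx.plug, Expr.app.injEq] at h
    exact absurd ⟨_, h.1⟩ (hv H)
  | .appL _ _, .hole | .appR _ _, .hole | .reset _ _, .hole | .appL _ _, .reset _ _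
  | .appR _ _, .reset _ _ | .reset _ _, .appL _ _ | .reset _ _, .appR _ _ => cases h

/-- The only step of an expression in which a capture is in evaluation position. -/
theorem red_plug_grab_iff {n : ℕ} {p : Prompt} {b : Expr (n + 1)} {H : ECtx n} {e : Expr n} :
    Red (H.plug (.grab (.prompt p) b)) e ↔
      ∃ E D : ECtx n, H = E.comp (.reset p D) ∧ p ∉ D.surr ∧
        PromptsFresh (b.inst (.cont D)).prompts
          (Expr.reset (.prompt p) (D.plug (.grab (.prompt p) b))).prompts E.prompts ∧
        e = E.plug (b.inst (.cont D)) := by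
  constructor
  · intro h
    obtain ⟨E, r, s, hrs, hf, heq, rfl⟩ := red_iff_head.1 h
    obtain ⟨D, rfl, rfl⟩ := plug_eq_plug_grab hrs heq
    obtain ⟨D, rfl, hp, rfl⟩ := hrs.eq_of_plug_grab
    exact ⟨E, D, rfl, hp, hf, rfl⟩
  · rintro ⟨E, D, rfl, hp, hf, rfl⟩
    rw [ECtx.plug_comp]
    exact .compat E _ _ (.grab p D b hp) hf

theorem ECtx.Sim.comp_left {p : Prompt} {n : ℕ} {E D H : ECtx n}
    (h : ECtx.Sim p (E.comp D) H) :
    ∃ E' D', H = E'.comp D' ∧ ECtx.Sim p E E' ∧ ECtx.Sim p D D' := by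
  match E with
  | .hole => exact ⟨.hole, H, rfl, .hole, h⟩
  | .appL E e =>
    cases h with
    | appL h₁ h₂ =>
      obtain ⟨E', D', rfl, hE, hD⟩ := ECtx.Sim.comp_left h₁
      exact ⟨.appL E' _, D', rfl, .appL hE h₂, hD⟩
  | .appR v E =>
    cases h with
    | appR h₁ h₂ =>
      obtain ⟨E', D', rfl, hE, hD⟩ := ECtx.Sim.comp_left h₂
      exact ⟨.appR _ E', D', rfl, .appR h₁ hE, hD⟩
  | .reset q E =>
    cases h with
    | reset _ h =>
      obtain ⟨E', D', rfl, hE, hD⟩ := ECtx.Sim.comp_left h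
      exact ⟨.reset q E', D', rfl, .reset q hE, hD⟩

theorem ECtx.Sim.comp_right {p : Prompt} {n : ℕ} {E' D' H : ECtx n}
    (h : ECtx.Sim p H (E'.comp D')) :
    ∃ E D, H = E.comp D ∧ ECtx.Sim p E E' ∧ ECtx.Sim p D D' := by
  match E' with
  | .hole => exact ⟨.hole, H, rfl, .hole, h⟩
  | .appL E e =>
    cases h with
    | appL h₁ h₂ =>
      obtain ⟨E', D', rfl, hE, hD⟩ := ECtx.Sim.comp_right h₁
      exact ⟨.appL E' _, D', rfl, .appL hE h₂, hD⟩
  | .appR v E =>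
    cases h with
    | appR h₁ h₂ =>
      obtain ⟨E', D', rfl, hE, hD⟩ := ECtx.Sim.comp_right h₂
      exact ⟨.appR _ E', D', rfl, .appR h₁ hE, hD⟩
  | .reset q E =>
    cases h with
    | reset _ h =>
      obtain ⟨E', D', rfl, hE, hD⟩ := ECtx.Sim.comp_right h
      exact ⟨.reset q E', D', rfl, .reset q hE, hD⟩

section

variable {p q : Prompt} {n : ℕ} {H H' : ECtx n} {b b' : Expr (n + 1)} {e e' : Expr n}

theorem red_grab_left (hH : ECtx.Sim p H H') (hb : Expr.Sim p b b')
    (h : Red (H.plug (.grab (.prompt q) b)) e) :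
    ∃ e', Red (H'.plug (.grab (.prompt q) b')) e' ∧ Expr.Sim p e e' := by
  obtain ⟨E, D, rfl, hq, hf, rfl⟩ := red_plug_grab_iff.1 h
  obtain ⟨E', _, rfl, hE, hD⟩ := hH.comp_left
  cases hD with
  | reset _ hD =>
    have hi := hb.inst (.cont hD)
    have hr := Expr.Sim.reset (.prompt q) (hD.plug (.grab (.prompt q) hb))
    exact ⟨_, red_plug_grab_iff.2 ⟨E', _, rfl, hD.surr_eq ▸ hq,
      hi.prompts_eq ▸ hr.prompts_eq ▸ hE.prompts_eq ▸ hf, rfl⟩, hE.plug hi⟩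

theorem red_grab_right (hH : ECtx.Sim p H H') (hb : Expr.Sim p b b')
    (h : Red (H'.plug (.grab (.prompt q) b')) e') :
    ∃ e, Red (H.plug (.grab (.prompt q) b)) e ∧ Expr.Sim p e e' := by
  obtain ⟨E', D', rfl, hq, hf, rfl⟩ := red_plug_grab_iff.1 h
  obtain ⟨E, _, rfl, hE, hD⟩ := hH.comp_right
  cases hD with
  | reset _ hD =>
    have hi := hb.inst (.cont hD)
    have hr := Expr.Sim.reset (.prompt q) (hD.plug (.grab (.prompt q) hb))
    exact ⟨_, red_plug_grab_iff.2 ⟨E, _, rfl, hD.surr_eq ▸ hq,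
      by rwa [hi.prompts_eq, hr.prompts_eq, hE.prompts_eq], rfl⟩, hE.plug hi⟩

theorem redOrNormal_grab_left (hH : ECtx.Sim p H H') (hb : Expr.Sim p b b')
    (h : RedOrNormal (H.plug (.grab (.prompt q) b)) e) :
    ∃ e', RedOrNormal (H'.plug (.grab (.prompt q) b')) e' ∧ Expr.Sim p e e' := by
  rcases h with h | ⟨h, rfl⟩
  · obtain ⟨e', h, he⟩ := red_grab_left hH hb h
    exact ⟨e', .inl h, he⟩
  · refine ⟨_, .inr ⟨?_, rfl⟩, hH.plug (.grab (.prompt q) hb)⟩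
    rintro ⟨x, hx⟩
    obtain ⟨y, hy, _⟩ := red_grab_right hH hb hx
    exact h ⟨y, hy⟩

theorem redOrNormal_grab_right (hH : ECtx.Sim p H H') (hb : Expr.Sim p b b')
    (h : RedOrNormal (H'.plug (.grab (.prompt q) b')) e') :
    ∃ e, RedOrNormal (H.plug (.grab (.prompt q) b)) e ∧ Expr.Sim p e e' := by
  rcases h with h | ⟨h, rfl⟩
  · obtain ⟨e, h, he⟩ := red_grab_right hH hb h
    exact ⟨e, .inl h, he⟩
  · refine ⟨_, .inr ⟨?_, rfl⟩, hH.plug (.grab (.prompt q) hb)⟩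
    rintro ⟨x, hx⟩
    obtain ⟨y, hy, _⟩ := red_grab_left hH hb hx
    exact h ⟨y, hy⟩

end

/-! ## Environments -/

/-- Related environments. -/
abbrev Env.Sim (p : Prompt) (Γ Γ' : Env) : Prop := List.Forall₂ (Val.Sim p) Γ Γ'

section

variable {p : Prompt} {Γ Γ' : Env}

theorem Env.Sim.getElem? (h : Env.Sim p Γ Γ') (i : ℕ) :
    Option.Rel (Val.Sim p) Γ[i]? Γ'[i]? := by
  induction h generalizing i with
  | nil => exact .none
  | cons h _ ih =>
    cases i with
    | zero => exact .some h
    | succ i => simpa using ih i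

theorem Env.Sim.prompts_eq (h : Env.Sim p Γ Γ') : Γ.prompts = Γ'.prompts := by
  induction h with
  | nil => rfl
  | cons h _ ih => simp only [Env.prompts, h.prompts_eq, ih]

theorem Env.Sim.concat (h : Env.Sim p Γ Γ') {v v' : Val 0} (hv : Val.Sim p v v') :
    Env.Sim p (Γ ++ [v]) (Γ' ++ [v']) := by
  induction h with
  | nil => exact .cons hv .nil
  | cons h _ ih => exact .cons h ih

theorem Env.Sim.valAt (h : Env.Sim p Γ Γ') {n : ℕ} (i : ℕ) :
    Val.Sim p (Γ.valAt i : Val n) (Γ'.valAt i) := by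
  have hi := h.getElem? i
  simp only [Env.valAt]
  generalize Γ[i]? = o at hi
  generalize Γ'[i]? = o' at hi
  cases hi with
  | none => exact .prompt 0
  | some h => exact h.rename _

theorem Env.Sim.getElem?_prompt_iff (h : Env.Sim p Γ Γ') (i : ℕ) (q : Prompt) :
    Γ[i]? = some (.prompt q) ↔ Γ'[i]? = some (.prompt q) := by
  have hi := h.getElem? i
  generalize Γ[i]? = o at hi
  generalize Γ'[i]? = o' at hi
  cases hi with
  | none => rfl
  | some h => cases h <;> simp [shiftOp, shiftOp', resumeFun, promptFun]

theorem Env.Sim.promptAt_eq (h : Env.Sim p Γ Γ') (i : ℕ) : Γ.promptAt i = Γ'.promptAt i := by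
  have hi := h.getElem? i
  simp only [Env.promptAt]
  generalize Γ[i]? = o at hi
  generalize Γ'[i]? = o' at hi
  cases hi with
  | none => rfl
  | some h => cases h <;> rfl

mutual

theorem MExpr.fill_sim (h : Env.Sim p Γ Γ') {n : ℕ} :
    ∀ C : MExpr n, Expr.Sim p (C.fill Γ) (C.fill Γ')
  | .val V => .val (V.fill_sim h)
  | .app C₁ C₂ => .app (C₁.fill_sim h) (C₂.fill_sim h)
  | .fresh C => .fresh (C.fill_sim h)
  | .reset V C => .reset (V.fill_sim h) (C.fill_sim h)
  | .grab V C => .grab (V.fill_sim h) (C.fill_sim h)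
  | .throw V C => .throw (V.fill_sim h) (C.fill_sim h)

theorem MVal.fill_sim (h : Env.Sim p Γ Γ') {n : ℕ} :
    ∀ V : MVal n, Val.Sim p (V.fill Γ) (V.fill Γ')
  | .var x => .var x
  | .lam C => .lam (C.fill_sim h)
  | .cont F => .cont (F.fill_sim h)
  | .idx i => h.valAt i

theorem MCtx.fill_sim (h : Env.Sim p Γ Γ') {n : ℕ} :
    ∀ F : MCtx n, ECtx.Sim p (F.fill Γ) (F.fill Γ')
  | .hole => .hole
  | .appL F C => .appL (F.fill_sim h) (C.fill_sim h)
  | .appR V F => .appR (V.fill_sim h) (F.fill_sim h)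
  | .reset i F => by
      simp only [MCtx.fill, h.promptAt_eq i]
      exact .reset _ (F.fill_sim h)

end

mutual

theorem MExpr.fits_iff (h : Env.Sim p Γ Γ') {n : ℕ} :
    ∀ C : MExpr n, C.Fits Γ ↔ C.Fits Γ'
  | .val V => by simp only [MExpr.Fits, V.fits_iff h]
  | .app C₁ C₂ => by simp only [MExpr.Fits, C₁.fits_iff h, C₂.fits_iff h]
  | .fresh C => by simp only [MExpr.Fits, C.fits_iff h]
  | .reset V C => by simp only [MExpr.Fits, V.fits_iff h, C.fits_iff h]
  | .grab V C => by simp only [MExpr.Fits, V.fits_iff h, C.fits_iff h]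
  | .throw V C => by simp only [MExpr.Fits, V.fits_iff h, C.fits_iff h]

theorem MVal.fits_iff (h : Env.Sim p Γ Γ') {n : ℕ} :
    ∀ V : MVal n, V.Fits Γ ↔ V.Fits Γ'
  | .var x => .rfl
  | .lam C => by simp only [MVal.Fits, C.fits_iff h]
  | .cont F => by simp only [MVal.Fits, F.fits_iff h]
  | .idx i => by simp only [MVal.Fits, h.length_eq]

theorem MCtx.fits_iff (h : Env.Sim p Γ Γ') {n : ℕ} :
    ∀ F : MCtx n, F.Fits Γ ↔ F.Fits Γ'
  | .hole => .rfl
  | .appL F C => by simp only [MCtx.Fits, F.fits_iff h, C.fits_iff h]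
  | .appR V F => by simp only [MCtx.Fits, V.fits_iff h, F.fits_iff h]
  | .reset i F => by simp only [MCtx.Fits, F.fits_iff h, h.getElem?_prompt_iff]

end

end

/-! ## The bisimulation -/

/-- The expressions that are redexes only as a whole. -/
def Expr.IsCall {n : ℕ} (e : Expr n) : Prop :=
  (∃ v w, e = .app (.val v) (.val w)) ∨ ∃ v a, e = .throw v a

theorem Expr.IsCall.not_isVal {n : ℕ} {e : Expr n} (h : e.IsCall) : ¬ e.IsVal := by
  rintro ⟨v, rfl⟩
  rcases h with ⟨_, _, h⟩ | ⟨_, _, h⟩ <;> cases h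

theorem Expr.IsCall.eq_hole {n : ℕ} {E : ECtx n} {r : Expr n} (h : (E.plug r).IsCall)
    (hr : ¬ r.IsVal) : E = .hole := by
  cases E with
  | hole => rfl
  | appL E e =>
    rcases h with ⟨v, w, h⟩ | ⟨_, _, h⟩
    · simp only [ECtx.plug, Expr.app.injEq] at h
      exact absurd ⟨v, h.1⟩ (ECtx.not_isVal_plug hr)
    · cases h
  | appR _ E =>
    rcases h with ⟨v, w, h⟩ | ⟨_, _, h⟩
    · simp only [ECtx.plug, Expr.app.injEq] at h
      exact absurd ⟨w, h.2⟩ (ECtx.not_isVal_plug hr)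
    · cases h
  | reset q E => rcases h with ⟨_, _, h⟩ | ⟨_, _, h⟩ <;> cases h

theorem Expr.IsCall.red_eq {n : ℕ} {e s s' : Expr n} (h : e.IsCall) (hs : Head e s)
    (hs' : Red e s') : s' = s := by
  obtain ⟨E, r, t, hrt, _, rfl, rfl⟩ := red_iff_head.1 hs'
  obtain rfl := h.eq_hole hrt.not_isVal
  rcases h with ⟨v, w, h⟩ | ⟨v, a, h⟩
  · simp only [ECtx.plug] at h hs ⊢
    subst h
    cases hs; cases hrt; rfl
  · simp only [ECtx.plug] at h hs ⊢
    subst h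
    exact hrt.throw_eq hs

theorem Expr.IsCall.ne_plug_grab {n : ℕ} {E : ECtx n} {v : Val n} {b : Expr (n + 1)}
    (h : (E.plug (.grab v b)).IsCall) : False := by
  obtain rfl := h.eq_hole (not_isVal_grab v b)
  rcases h with ⟨_, _, h⟩ | ⟨_, _, h⟩ <;> cases h

/-- The second expression is one deterministic step behind an expression related to the first. -/
structure Expr.LagVia (p : Prompt) {n : ℕ} (e e' d : Expr n) : Prop where
  sim : Expr.Sim p e d
  not_isVal : ¬ e.IsVal
  isCall : e'.IsCall
  head : Head e' d
  prompts_eq : e'.prompts = d.prompts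

/-- The relation on expressions of states: bodies of functions called by the environment may
have lost the call that relates them. -/
def Expr.LagSim (p : Prompt) {n : ℕ} (e e' : Expr n) : Prop :=
  Expr.Sim p e e' ∨ ∃ d, Expr.LagVia p e e' d

theorem Val.Sim.lam_iff {p : Prompt} {n : ℕ} {v v' : Val n} (h : Val.Sim p v v') :
    (∃ b, v = .lam b) ↔ ∃ b, v' = .lam b := by
  cases h <;> simp [shiftOp, shiftOp', resumeFun, promptFun]

theorem Val.Sim.inst_lagSim {p : Prompt} {n : ℕ} {v v' w w' : Val n} {b b' : Expr (n + 1)}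
    (h : Val.Sim p v v') (hv : v = .lam b) (hv' : v' = .lam b') (hw : Val.Sim p w w') :
    Expr.LagSim p (b.inst w) (b'.inst w') := by
  have hb : Head (.app (.val v) (.val w)) (b.inst w) := hv ▸ .beta b w
  have hb' : Head (.app (.val v') (.val w')) (b'.inst w') := hv' ▸ .beta b' w'
  cases h with
  | var | prompt | cont => cases hv
  | lam h =>
    cases hv
    cases hv'
    exact .inl (h.inst hw)
  | shift =>
    rw [hb.beta_eq (head_shiftOp p w), hb'.beta_eq (head_shiftOp' p w')]
    refine .inr ⟨_, sim_grab_body hw, not_isVal_grab _ _, .inl ⟨_, _, rfl⟩, head_controlOp p _, ?_⟩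
    ext q
    simp [Expr.prompts, Val.prompts, ECtx.prompts, controlOp, throwFun, wrapFun, promptFun,
      promptOp, Val.rename, Val.prompts_rename, Expr.prompts_rename]
  | resume hu =>
    rw [hb.beta_eq (head_resumeFun p _ w), hb'.beta_eq (head_promptFun p _ w')]
    refine .inr ⟨_, sim_reset_throw hu hw, ?_, .inr ⟨_, _, rfl⟩, head_promptOp p _, ?_⟩
    · rintro ⟨v, hv⟩
      cases hv
    · simp [Expr.prompts, Val.prompts, ECtx.prompts, promptOp]

/-- Related states. -/
inductive State.Sim (p : Prompt) : State → State → Prop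
  | vals {Γ Γ' : Env} (h : Env.Sim p Γ Γ') : State.Sim p (.vals Γ) (.vals Γ')
  | run {Γ Γ' : Env} {e e' : Expr 0} (h : Env.Sim p Γ Γ') (he : Expr.LagSim p e e')
      (hv : ¬ e.IsVal) (hv' : ¬ e'.IsVal) : State.Sim p (.run Γ e hv) (.run Γ' e' hv')

theorem State.Sim.of_lag {p : Prompt} {Γ Γ' : Env} {e e' : Expr 0} (h : Env.Sim p Γ Γ')
    (he : Expr.LagSim p e e') : State.Sim p (.of Γ e) (.of Γ' e') := by
  by_cases hv : e.IsVal
  · obtain ⟨v, rfl⟩ := hv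
    rcases he with he | ⟨d, he⟩
    · cases he with
      | val hv =>
        rw [State.of_val, State.of_val]
        exact .vals (h.concat hv)
    · exact absurd ⟨v, rfl⟩ he.not_isVal
  · have hv' : ¬ e'.IsVal := by
      rcases he with he | ⟨d, he⟩
      · exact mt he.isVal_iff.2 hv
      · exact he.isCall.not_isVal
    rw [State.of_not_val _ _ hv, State.of_not_val _ _ hv']
    exact .run h he hv hv'

theorem State.Sim.of {p : Prompt} {Γ Γ' : Env} {e e' : Expr 0} (h : Env.Sim p Γ Γ')
    (he : Expr.Sim p e e') : State.Sim p (.of Γ e) (.of Γ' e') :=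
  .of_lag h (.inl he)

theorem Step.of_red {Γ : Env} {e₁ e₂ : Expr 0} (h : Red e₁ e₂)
    (hf : PromptsFresh e₂.prompts e₁.prompts Γ.prompts) :
    Step (.of Γ e₁) .tau (.of Γ e₂) := by
  have hv : ¬ e₁.IsVal := by
    obtain ⟨E, r, s, hrs, _, rfl, _⟩ := red_iff_head.1 h
    exact ECtx.not_isVal_plug hrs.not_isVal
  rw [State.of_not_val _ _ hv]
  exact .tau Γ e₁ e₂ hv h hf

theorem WeakStep.of_step {s t : State} {a : Label} (h : Step s a t) : WeakStep s a t := by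
  by_cases ha : a = .tau
  · subst ha
    exact .inl ⟨rfl, .single h⟩
  · exact .inr ⟨ha, s, t, .refl, h, .refl⟩

section

variable {p : Prompt} {Γ Γ' : Env} {E E' : ECtx 0}

theorem Step.of_head {r s : Expr 0} (h : Head r s)
    (hf : PromptsFresh s.prompts r.prompts E.prompts)
    (hf' : PromptsFresh s.prompts r.prompts Γ.prompts) :
    Step (.of Γ (E.plug r)) .tau (.of Γ (E.plug s)) := by
  refine .of_red (.compat E r s h.red hf) ?_
  rw [promptsFresh_iff] at hf' ⊢
  simp only [ECtx.prompts_plug, Finset.mem_union]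
  rintro q (hq | hq) hΓ
  · exact .inl hq
  · exact .inr (hf' q hq hΓ)

theorem PromptsFresh.of_plug {E : ECtx 0} {r s : Expr 0}
    (hf : PromptsFresh s.prompts r.prompts E.prompts)
    (hf' : PromptsFresh (E.plug s).prompts (E.plug r).prompts Γ.prompts) :
    PromptsFresh s.prompts r.prompts Γ.prompts := by
  rw [promptsFresh_iff] at hf hf' ⊢
  simp only [ECtx.prompts_plug, Finset.mem_union] at hf'
  intro q hq hΓ
  rcases hf' q (.inr hq) hΓ with h | h
  · exact hf q hq h
  · exact h

theorem tauStar_of_adminSteps {r a b : Expr 0}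
    (h : Relation.ReflTransGen (AdminStep p r) a b) :
    TauStar (.of Γ (E.plug a)) (.of Γ (E.plug b)) := by
  induction h with
  | refl => exact .refl
  | tail _ h ih =>
    have hp := h.2.2.prompts_eq.symm.trans h.2.1.prompts_eq
    exact ih.tail (.of_head h.1 (.of_eq hp) (.of_eq hp))

theorem tau_left {e e' s : Expr 0} (hΓ : Env.Sim p Γ Γ') (he : Expr.Sim p e e')
    (h : Red e s) (hf : PromptsFresh s.prompts e.prompts Γ.prompts) :
    ∃ s', TauStar (.of Γ' e') (.of Γ' s') ∧ Expr.Sim p s s' := by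
  obtain ⟨E, r, s, hrs, hfE, rfl, rfl⟩ := red_iff_head.1 h
  obtain ⟨E', r', rfl, hE, hr⟩ := he.plug_left hrs.not_isVal
  obtain ⟨m, s', hm, hrm, hms, hs⟩ := hr.head_left hrs
  have hfΓ := hfE.of_plug hf
  rw [hs.prompts_eq, hrm.prompts_eq, hE.prompts_eq] at hfE
  rw [hs.prompts_eq, hrm.prompts_eq, hΓ.prompts_eq] at hfΓ
  exact ⟨E'.plug s', (tauStar_of_adminSteps hm).tail (.of_head hms hfE hfΓ), hE.plug hs⟩

theorem tau_right {e e' s' : Expr 0} (hΓ : Env.Sim p Γ Γ') (he : Expr.Sim p e e')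
    (h : Red e' s') (hf : PromptsFresh s'.prompts e'.prompts Γ'.prompts) :
    ∃ s, TauStar (.of Γ e) (.of Γ s) ∧ Expr.Sim p s s' := by
  obtain ⟨E', r', s', hrs, hfE, rfl, rfl⟩ := red_iff_head.1 h
  obtain ⟨E, r, rfl, hE, hr⟩ := he.plug_right hrs.not_isVal
  rcases hr.head_right hrs with hs | ⟨s, hrs, hs⟩
  · exact ⟨E.plug r, .refl, hE.plug hs⟩
  · have hfΓ := hfE.of_plug hf
    rw [← hs.prompts_eq, ← hr.prompts_eq, ← hE.prompts_eq] at hfE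
    rw [← hs.prompts_eq, ← hr.prompts_eq, ← hΓ.prompts_eq] at hfΓ
    exact ⟨E.plug s, .single (.of_head hrs hfE hfΓ), hE.plug hs⟩

end

theorem WeakStep.of_tauStar {s t : State} (h : TauStar s t) : WeakStep s .tau t :=
  .inl ⟨rfl, h⟩

theorem WeakStep.tau_head {s t u : State} {a : Label} (h : Step s .tau t) (hw : WeakStep t a u) :
    WeakStep s a u := by
  rcases hw with ⟨rfl, hw⟩ | ⟨ha, s₁, s₂, h₁, h₂, h₃⟩
  · exact .inl ⟨rfl, .head h hw⟩
  · exact .inr ⟨ha, s₁, s₂, .head h h₁, h₂, h₃⟩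

theorem Step.of_stuck {Γ : Env} {p : Prompt} {E : ECtx 0} {b : Expr 1} {e' : Expr 0}
    {F : MCtx 0} (hp : p ∉ E.surr) (hF : F.Fits Γ)
    (h : RedOrNormal (((F.fill Γ).comp E).plug (.grab (.prompt p) b)) e') :
    Step (.of Γ (E.plug (.grab (.prompt p) b))) (.stuck F) (.of Γ e') := by
  have hv := E.not_isVal_plug (not_isVal_grab (.prompt p) b)
  rw [State.of_not_val _ _ hv]
  rw [ECtx.plug_comp] at h
  exact .stuck Γ _ hv p E b e' F hp rfl hF h

section

variable {p : Prompt} {Γ Γ' : Env}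

theorem Env.Sim.exists_right (h : Env.Sim p Γ Γ') {i : ℕ} {v : Val 0} (hi : Γ[i]? = some v) :
    ∃ v', Γ'[i]? = some v' ∧ Val.Sim p v v' := by
  have := h.getElem? i
  rw [hi] at this
  generalize Γ'[i]? = o at this
  cases this with
  | some h => exact ⟨_, rfl, h⟩

theorem Env.Sim.exists_left (h : Env.Sim p Γ Γ') {i : ℕ} {v' : Val 0}
    (hi : Γ'[i]? = some v') : ∃ v, Γ[i]? = some v ∧ Val.Sim p v v' := by
  have := h.getElem? i
  rw [hi] at this
  generalize Γ[i]? = o at this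
  cases this with
  | some h => exact ⟨_, rfl, h⟩

theorem vals_left {a : Label} {s : State} (hΓ : Env.Sim p Γ Γ') (hs : Step (.vals Γ) a s) :
    ∃ t, Step (.vals Γ') a t ∧ State.Sim p s t := by
  cases hs with
  | lam _ i b V hi hV =>
    obtain ⟨v', hi', hv⟩ := hΓ.exists_right hi
    obtain ⟨b', rfl⟩ := hv.lam_iff.1 ⟨b, rfl⟩
    exact ⟨_, .lam Γ' i b' V hi' ((V.fits_iff hΓ).1 hV),
      .of_lag hΓ (hv.inst_lagSim rfl rfl (V.fill_sim hΓ))⟩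
  | val => exact ⟨_, .val Γ', .vals hΓ⟩
  | ctx _ i E C hi hC =>
    obtain ⟨v', hi', hv⟩ := hΓ.exists_right hi
    cases hv with
    | cont hE =>
      exact ⟨_, .ctx Γ' i _ C hi' ((C.fits_iff hΓ).1 hC), .of hΓ (hE.plug (C.fill_sim hΓ))⟩
  | prompt _ i j q hi hj =>
    exact ⟨_, .prompt Γ' i j q ((hΓ.getElem?_prompt_iff i q).1 hi)
      ((hΓ.getElem?_prompt_iff j q).1 hj), .vals hΓ⟩
  | newPrompt _ q hq =>
    exact ⟨_, .newPrompt Γ' q (hΓ.prompts_eq ▸ hq), .vals (hΓ.concat (.prompt q))⟩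

theorem vals_right {a : Label} {t : State} (hΓ : Env.Sim p Γ Γ') (ht : Step (.vals Γ') a t) :
    ∃ s, Step (.vals Γ) a s ∧ State.Sim p s t := by
  cases ht with
  | lam _ i b' V hi hV =>
    obtain ⟨v, hi', hv⟩ := hΓ.exists_left hi
    obtain ⟨b, rfl⟩ := hv.lam_iff.2 ⟨b', rfl⟩
    exact ⟨_, .lam Γ i b V hi' ((V.fits_iff hΓ).2 hV),
      .of_lag hΓ (hv.inst_lagSim rfl rfl (V.fill_sim hΓ))⟩
  | val => exact ⟨_, .val Γ, .vals hΓ⟩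
  | ctx _ i E' C hi hC =>
    obtain ⟨v, hi', hv⟩ := hΓ.exists_left hi
    cases hv with
    | cont hE =>
      exact ⟨_, .ctx Γ i _ C hi' ((C.fits_iff hΓ).2 hC), .of hΓ (hE.plug (C.fill_sim hΓ))⟩
  | prompt _ i j q hi hj =>
    exact ⟨_, .prompt Γ i j q ((hΓ.getElem?_prompt_iff i q).2 hi)
      ((hΓ.getElem?_prompt_iff j q).2 hj), .vals hΓ⟩
  | newPrompt _ q hq =>
    exact ⟨_, .newPrompt Γ q (hΓ.prompts_eq ▸ hq), .vals (hΓ.concat (.prompt q))⟩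

theorem run_left {a : Label} {s : State} {e e' : Expr 0} {hv : ¬ e.IsVal}
    (hΓ : Env.Sim p Γ Γ') (he : Expr.Sim p e e') (hs : Step (.run Γ e hv) a s) :
    ∃ t, WeakStep (.of Γ' e') a t ∧ State.Sim p s t := by
  cases hs with
  | tau _ _ e₂ _ h hf =>
    obtain ⟨s', hs', hse⟩ := tau_left hΓ he h hf
    exact ⟨_, .of_tauStar hs', .of hΓ hse⟩
  | stuck _ _ _ q E b d F hq heq hF h =>
    subst heq
    obtain ⟨E', r', rfl, hE, hr⟩ := he.plug_left (not_isVal_grab _ b)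
    cases hr with
    | grab h₁ hb =>
      cases h₁ with
      | prompt =>
        rw [← ECtx.plug_comp] at h
        obtain ⟨d', h', hd⟩ := redOrNormal_grab_left ((F.fill_sim hΓ).comp hE) hb h
        exact ⟨_, .of_step (.of_stuck (hE.surr_eq ▸ hq) ((F.fits_iff hΓ).1 hF) h'), .of hΓ hd⟩

theorem run_right {a : Label} {t : State} {e e' : Expr 0} {hv : ¬ e'.IsVal}
    (hΓ : Env.Sim p Γ Γ') (he : Expr.Sim p e e') (ht : Step (.run Γ' e' hv) a t) :
    ∃ s, WeakStep (.of Γ e) a s ∧ State.Sim p s t := by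
  cases ht with
  | tau _ _ e₂ _ h hf =>
    obtain ⟨s, hs, hse⟩ := tau_right hΓ he h hf
    exact ⟨_, .of_tauStar hs, .of hΓ hse⟩
  | stuck _ _ _ q E' b' d' F hq heq hF h =>
    subst heq
    obtain ⟨E, r, rfl, hE, hr⟩ := he.plug_right (not_isVal_grab _ b')
    cases hr with
    | grab h₁ hb =>
      cases h₁ with
      | prompt =>
        rw [← ECtx.plug_comp] at h
        obtain ⟨d, h', hd⟩ := redOrNormal_grab_right ((F.fill_sim hΓ).comp hE) hb h
        exact ⟨_, .of_step (.of_stuck (hE.surr_eq ▸ hq) ((F.fits_iff hΓ).2 hF) h'), .of hΓ hd⟩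

end

theorem State.Sim.step_left {p : Prompt} {s t s' : State} {a : Label} (h : State.Sim p s t)
    (hs : Step s a s') : ∃ t', WeakStep t a t' ∧ State.Sim p s' t' := by
  cases h with
  | vals hΓ =>
    obtain ⟨t, ht, h⟩ := vals_left hΓ hs
    exact ⟨t, .of_step ht, h⟩
  | run hΓ he hv hv' =>
    rw [← State.of_not_val _ _ hv']
    rcases he with he | ⟨d, he⟩
    · exact run_left hΓ he hs
    · obtain ⟨t, ht, h⟩ := run_left hΓ he.sim hs
      exact ⟨t, .tau_head (.of_red he.head.red (.of_eq he.prompts_eq.symm)) ht, h⟩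

theorem State.Sim.step_right {p : Prompt} {s t t' : State} {a : Label} (h : State.Sim p s t)
    (ht : Step t a t') : ∃ s', WeakStep s a s' ∧ State.Sim p s' t' := by
  cases h with
  | vals hΓ =>
    obtain ⟨s, hs, h⟩ := vals_right hΓ ht
    exact ⟨s, .of_step hs, h⟩
  | run hΓ he hv hv' =>
    rw [← State.of_not_val _ _ hv]
    rcases he with he | ⟨d, he⟩
    · exact run_right hΓ he ht
    · cases ht with
      | tau _ _ e₂ _ h _ =>
        obtain rfl := he.isCall.red_eq he.head h
        exact ⟨_, .of_tauStar .refl, .of hΓ he.sim⟩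
      | stuck _ _ _ q E b e₂ F _ heq _ _ => exact (heq ▸ he.isCall).ne_plug_grab.elim

theorem isBisimulation_sim (p : Prompt) : IsBisimulation (State.Sim p) :=
  ⟨fun _ _ h => h, fun _ _ h => ⟨fun _ _ => h.step_left, fun _ _ => h.step_right⟩⟩

theorem pairEnc_sim (p : Prompt) :
    Val.Sim p (pairEnc (shiftOp p) (resetOp p)) (pairEnc (shiftOp' p) (promptOp p)) :=
  .lam (.app (.app (.val (.var 0)) (.val .shift)) (.val (.cont (.reset p .hole))))

end MultiPrompt

theorem mainTheorem8 (p : MultiPrompt.Prompt) :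
    MultiPrompt.Bisimilar
      (MultiPrompt.State.of []
        (MultiPrompt.Expr.val
          (MultiPrompt.pairEnc (MultiPrompt.shiftOp p) (MultiPrompt.resetOp p))))
      (MultiPrompt.State.of []
        (MultiPrompt.Expr.val
          (MultiPrompt.pairEnc (MultiPrompt.shiftOp' p) (MultiPrompt.promptOp p)))) :=
  ⟨MultiPrompt.State.Sim p, MultiPrompt.isBisimulation_sim p,
    .of .nil (.val (MultiPrompt.pairEnc_sim p))⟩
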